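/- Let $\gamma,p\in\mathbb R$. Let $\mathcal K_{\gamma,p}$ be the class of continuous kernels $K:(0,\infty)^2\to\mathbb R$ of the form $K(x,y)=(x+y)^{\gamma}\,\Phi\!\left(\frac{x}{x+y}\right)$, where $\Phi(s)=K(s,1-s)=\Phi(1-s)$ is continuous and strictly positive on $(0,1)$ and $\lim_{s\to0^+}s^{p}\Phi(s)$ exists and is strictly positive. Equip $\mathcal K_{\gamma,p}$ with the topology generated by the (possibly infinite) metric $$\mathrm{dist}(\Phi_1,\Phi_2)=\sup\{s^{p}|\Phi_1(s)-\Phi_2(s)|:0<s<1\}.$$ For a kernel $K$ and $J_0>0$, a constant flux solution is a continuous function $f:(0,\infty)\to[0,\infty)$ with $$J(x;f):=\int_0^x dy\int_{x-y}^\infty dz\,K(y,z)\,y\,f(y)f(z)=J_0\qquad\text{for every }x>0 .$$ **Theorem.** Let $J_0>0$ and let $\gamma,p\in\mathbb R$ satisfy $0\le\gamma+2p<1$. There exist $\delta>0$, a continuous map $K:(-\delta,\delta)\to\mathcal K_{\gamma,p}$ and a number $Q>1$ such that for every $\delta_0\in(-\delta,\delta)\setminus\{0\}$ there are at least two different constant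 flux solutions for the kernel $K(\delta_0)$: 1. the power law $f(x)=C_0x^{-(\gamma+3)/2}$ with $C_0=b_{\Phi,\gamma}\sqrt{J_0}>0$, where $\Phi$ is the function associated with $K(\delta_0)$ and $$b_{\Phi,\gamma}=\left(\int_0^1dy\int_{1-y}^\infty dz\,\frac{(y+z)^\gamma}{y^{(\gamma+1)/2}z^{(\gamma+3)/2}}\,\Phi\!\left(\frac{y}{y+z}\right)\right)^{-1/2};$$ 2. a solution $f_{\delta_0}$ with $f_{\delta_0}(Qx)=Q^{-(\gamma+3)/2}f_{\delta_0}(x)$ for all $x>0$ (the number $Q$ being independent of $\delta_0$), which is not a power law on $(1,Q)$: there are no $C,a\in\mathbb R$ with $f_{\delta_0}(x)=Cx^{a}$ for all $x\in(1,Q)$. -/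

import Mathlib

open Set Filter Topology MeasureTheory
open scoped ENNReal

namespace Coagulation

/-- The angular part `Φ(s) = K(s, 1 - s)` of a homogeneous kernel `K`, relevant for `0 < s < 1`. -/
def angularPart (K : ℝ → ℝ → ℝ) (s : ℝ) : ℝ := K s (1 - s)

/-- `K` (through its values on `(0,∞)²`) belongs to the class `𝒦_{γ,p}`: `K` is continuous on
`(0,∞)²`, `K(x,y) = (x+y)^γ Φ(x/(x+y))` with `Φ(s) = K(s,1-s) = Φ(1-s)` continuous and
strictly positive on `(0,1)`, and `s^p Φ(s)` has a strictly positive limit as `s → 0⁺`. -/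
structure IsAdmissibleKernel (γ p : ℝ) (K : ℝ → ℝ → ℝ) : Prop where
  continuousOn_kernel : ContinuousOn (fun q : ℝ × ℝ => K q.1 q.2) (Ioi 0 ×ˢ Ioi 0)
  homogeneous_form : ∀ x > 0, ∀ y > 0, K x y = (x + y) ^ γ * angularPart K (x / (x + y))
  symmetric : ∀ s ∈ Ioo (0 : ℝ) 1, angularPart K s = angularPart K (1 - s)
  continuousOn_angular : ContinuousOn (angularPart K) (Ioo 0 1)
  positive : ∀ s ∈ Ioo (0 : ℝ) 1, 0 < angularPart K s
  limit_zero : ∃ a : ℝ, 0 < a ∧ Tendsto (fun s => s ^ p * angularPart K s) (𝓝[>] 0) (𝓝 a)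

/-- The class `𝒦_{γ,p}` of kernels. -/
def KernelClass (γ p : ℝ) : Type := {K : ℝ → ℝ → ℝ // IsAdmissibleKernel γ p K}

/-- `dist(Φ₁, Φ₂) = sup { s^p |Φ₁(s) - Φ₂(s)| : 0 < s < 1 }`, with values in `[0, ∞]`. -/
noncomputable def angularDist (p : ℝ) (Φ₁ Φ₂ : ℝ → ℝ) : ℝ≥0∞ :=
  ⨆ s ∈ Ioo (0 : ℝ) 1, ENNReal.ofReal (s ^ p * |Φ₁ s - Φ₂ s|)

theorem angularDist_triangle (p : ℝ) (Φ₁ Φ₂ Φ₃ : ℝ → ℝ) :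
    angularDist p Φ₁ Φ₃ ≤ angularDist p Φ₁ Φ₂ + angularDist p Φ₂ Φ₃ := by
  refine iSup₂_le fun s hs => ?_
  have hp : 0 ≤ s ^ p := Real.rpow_nonneg hs.1.le p
  have h : s ^ p * |Φ₁ s - Φ₃ s| ≤ s ^ p * |Φ₁ s - Φ₂ s| + s ^ p * |Φ₂ s - Φ₃ s| := by
    rw [← mul_add]
    exact mul_le_mul_of_nonneg_left (abs_sub_le _ _ _) hp
  refine (ENNReal.ofReal_le_ofReal h).trans (ENNReal.ofReal_add_le.trans ?_)
  exact add_le_add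
    (le_iSup₂ (f := fun s (_ : s ∈ Ioo (0 : ℝ) 1) =>
      ENNReal.ofReal (s ^ p * |Φ₁ s - Φ₂ s|)) s hs)
    (le_iSup₂ (f := fun s (_ : s ∈ Ioo (0 : ℝ) 1) =>
      ENNReal.ofReal (s ^ p * |Φ₂ s - Φ₃ s|)) s hs)

/-- The weighted sup metric on `𝒦_{γ,p}` (and the topology generated by it). Only a
pseudo-metric because kernels are represented by functions on all of `ℝ × ℝ`, and it may
take the value `∞`. -/
noncomputable instance instKernelMetric (γ p : ℝ) : PseudoEMetricSpace (KernelClass γ p) where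
  edist K L := angularDist p (angularPart K.1) (angularPart L.1)
  edist_self K := by simp [angularDist]
  edist_comm K L := by simp only [angularDist, abs_sub_comm]
  edist_triangle K L M := angularDist_triangle p _ _ _

/-- The flux `J(x;f) = ∫₀^x dy ∫_{x-y}^∞ dz K(y,z) y f(y) f(z)` of a non-negative `f`, for a
non-negative kernel `K`; it is an element of `[0,∞]`. -/
noncomputable def flux (K : ℝ → ℝ → ℝ) (f : ℝ → ℝ) (x : ℝ) : ℝ≥0∞ :=
  ∫⁻ y in Ioo 0 x, ∫⁻ z in Ioi (x - y), ENNReal.ofReal (K y z * y * f y * f z)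

/-- `f` is a (continuous, non-negative) constant flux solution on `(0,∞)`:
`J(x;f) = J₀` for every `x > 0`. -/
structure IsConstantFluxSolution (K : ℝ → ℝ → ℝ) (J₀ : ℝ) (f : ℝ → ℝ) : Prop where
  continuousOn : ContinuousOn f (Ioi 0)
  nonneg : ∀ x > 0, 0 ≤ f x
  flux_eq : ∀ x > 0, flux K f x = ENNReal.ofReal J₀

/-- The constant `b_{Φ,γ} = (∫₀¹ dy ∫_{1-y}^∞ dz (y+z)^γ y^{-(γ+1)/2} z^{-(γ+3)/2} Φ(y/(y+z)))^{-1/2}`. -/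
noncomputable def bConst (γ : ℝ) (Φ : ℝ → ℝ) : ℝ :=
  (∫⁻ y in Ioo (0 : ℝ) 1, ∫⁻ z in Ioi (1 - y),
    ENNReal.ofReal ((y + z) ^ γ / (y ^ ((γ + 1) / 2) * z ^ ((γ + 3) / 2)) *
      Φ (y / (y + z)))).toReal ^ (-(1 / 2) : ℝ)

/-- The power law `x ↦ C₀ x^{-(γ+3)/2}` with `C₀ = b_{Φ,γ} √J₀`. -/
noncomputable def powerLawSolution (γ : ℝ) (K : ℝ → ℝ → ℝ) (J₀ : ℝ) (x : ℝ) : ℝ :=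
  bConst γ (angularPart K) * √J₀ * x ^ (-((γ + 3) / 2))

end Coagulation

/-! Take Φ(s) = w(s) (s(1-s))^((γ+3)/2) and f(x) = C x^(-(γ+3)/2) g(log x). With s = y/(y+z) and log
y as variables all powers cancel, and the flux at x becomes the integral over s in (0,1) of C² s
w(s) times the increment, from log x to log x - log s, of an antiderivative of g(t + log s) g(t +
log(1-s)). For g = 1 + 2ε cos ωt + (3/5)ε² cos 2ωt this product is a mean plus four Fourier modes,
so the flux is constant once four complex moments of w vanish (`flux_modulated_eq`). Symmetrizing s
↔ 1-s, these moments are integrals of w against a curve in ℂ⁴, `modeCurve`, that does not depend on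
ε, plus an ε² term in the first mode only.

The weight is built as (s(1-s))^(-q) + h₀ + X(ε) h₁ + Y(ε) h₂ with q = p + (γ+3)/2. The base fixes
the behaviour s^(-p) of Φ at 0; the bump h₀ ≥ 0 cancels the four moments of the base; h₁ and h₂ span
the first mode over ℝ, so small X, Y absorb the ε² term by a 2×2 linear system
(`exists_weight_family`).

The crux is that nonnegative bumps realize every moment vector (`exists_frequency_forall_bump`). If
not, Hahn–Banach gives a nonzero real functional that is nonnegative along the whole curve. For
large ω and s of size 1/ω, the phases s^(iω) and (1-s)^(iω) come close to any pair of unit numbers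
A, B while s → 0. By compactness a nonzero functional would be nonnegative on all vectors `modeVec 0
A B`, which `eq_zero_of_pairing_nonneg` excludes.

The second harmonic matters here: with the first alone, the weights -1 and 1/2 on the two remaining
modes pair to (1 - Re A)(1 - Re B) ≥ 0. -/

open scoped ComplexConjugate

namespace Coagulation

/-! ### Limiting mode vectors and nonnegative functionals on the torus -/

/-- Coefficients of `z, z², z³, z⁴` in `G(Az) G(Bz)` for `G(z) = 1 + z + 3/10 z²`. -/
noncomputable def pairCoeff (A B : ℂ) : Fin 4 → ℂ :=
  ![A + B, A * B + 3 / 10 * (A ^ 2 + B ^ 2), 3 / 10 * (A ^ 2 * B + A * B ^ 2),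
    9 / 100 * (A ^ 2 * B ^ 2)]

/-- The integrands of the first four Fourier modes of the flux, as functions of the fraction `s`
and of the phases `A = s^{iω}`, `B = (1-s)^{iω}`. -/
noncomputable def modeVec (s : ℝ) (A B : ℂ) (m : Fin 4) : ℂ :=
  pairCoeff A B m * (1 - s * conj A ^ (m.1 + 1) - (1 - s) * conj B ^ (m.1 + 1))

/-- The polynomial vanishes at 0, so nonnegativity makes 0 a minimum, where the derivative `a` must
vanish. -/
theorem eq_zero_of_forall_quartic_nonneg {a b c d : ℝ}
    (h : ∀ t : ℝ, 0 ≤ a * t + b * t ^ 2 + c * t ^ 3 + d * t ^ 4) : a = 0 := by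
  have hd : HasDerivAt (fun t : ℝ => a * t + b * t ^ 2 + c * t ^ 3 + d * t ^ 4) a 0 := by
    have := ((((hasDerivAt_id (0 : ℝ)).const_mul a).add
      ((hasDerivAt_pow 2 (0 : ℝ)).const_mul b)).add ((hasDerivAt_pow 3 (0 : ℝ)).const_mul c)).add
      ((hasDerivAt_pow 4 (0 : ℝ)).const_mul d)
    refine (this.congr_deriv (by norm_num)).congr_of_eventuallyEq (Eventually.of_forall fun t => ?_)
    simp
  have hm : IsLocalMin (fun t : ℝ => a * t + b * t ^ 2 + c * t ^ 3 + d * t ^ 4) 0 :=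
    Eventually.of_forall fun t => by simpa using h t
  exact hm.hasDerivAt_eq_zero hd

theorem modeVec_pairing_re (μ : Fin 4 → ℂ) (x y X Y : ℝ) (hX : X ^ 2 + Y ^ 2 = 1) :
    (∑ m, μ m * modeVec 0 ⟨x, y⟩ ⟨X, Y⟩ m).re =
      (μ 0).re * (x + X - 1 - (x * X + y * Y)) - (μ 0).im * (y + Y - (y * X - x * Y))
      + (μ 1).re * (-2 * y * Y
          + 3 / 10 * ((x ^ 2 - y ^ 2) * (1 - (X ^ 2 - Y ^ 2)) - 2 * x * y * (2 * X * Y)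
            + X ^ 2 - Y ^ 2 - 1))
      - (μ 1).im * (2 * x * Y
          + 3 / 10 * ((x ^ 2 - y ^ 2) * (2 * X * Y) + 2 * x * y * (1 - (X ^ 2 - Y ^ 2))
            + 2 * X * Y))
      + 3 / 10 * (μ 2).re * ((x ^ 2 - y ^ 2) * (X - (X ^ 2 - Y ^ 2)) - 2 * x * y * (Y + 2 * X * Y)
          + x * (X ^ 2 - Y ^ 2 - X) - y * (2 * X * Y + Y))
      - 3 / 10 * (μ 2).im * ((x ^ 2 - y ^ 2) * (Y + 2 * X * Y) + 2 * x * y * (X - (X ^ 2 - Y ^ 2))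
          + y * (X ^ 2 - Y ^ 2 - X) + x * (2 * X * Y + Y))
      - 9 / 100 * (μ 3).re * (2 * (2 * x * y) * (2 * X * Y))
      - 9 / 100 * (μ 3).im * (2 * (x ^ 2 - y ^ 2) * (2 * X * Y)) := by
  set A : ℂ := ⟨x, y⟩ with hA
  set B : ℂ := ⟨X, Y⟩ with hB
  have hBB : B * conj B = 1 := by
    rw [Complex.mul_conj, hB, Complex.normSq_mk]; norm_cast; nlinarith
  have e0 : modeVec 0 A B 0 = A - A * conj B + B - 1 := by
    simp [modeVec, pairCoeff]; linear_combination (-1) * hBB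
  have e1 : modeVec 0 A B 1 = A * B - A * conj B + 3 / 10 * (A ^ 2 - A ^ 2 * conj B ^ 2
      + B ^ 2 - 1) := by
    simp [modeVec, pairCoeff]
    linear_combination (-A * conj B - 3 / 10 * (B * conj B + 1)) * hBB
  have e2 : modeVec 0 A B 2 = 3 / 10 * (A ^ 2 * B - A ^ 2 * conj B ^ 2 + A * B ^ 2
      - A * conj B) := by
    simp [modeVec, pairCoeff]
    linear_combination (-3 / 10 * A ^ 2 * conj B ^ 2 - 3 / 10 * A * conj B * (B * conj B + 1)) * hBB
  have e3 : modeVec 0 A B 3 = 9 / 100 * (A ^ 2 * B ^ 2 - A ^ 2 * conj B ^ 2) := by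
    simp [modeVec, pairCoeff]
    linear_combination (-9 / 100 * A ^ 2 * conj B ^ 2 * (B * conj B + 1)) * hBB
  have r : ∀ z w : ℂ, (z * w).re = z.re * w.re - z.im * w.im := Complex.mul_re
  have c1 : (3 / 10 : ℂ) = ((3 / 10 : ℝ) : ℂ) := by norm_num
  have c2 : (9 / 100 : ℂ) = ((9 / 100 : ℝ) : ℂ) := by norm_num
  rw [Fin.sum_univ_four, e0, e1, e2, e3, c1, c2]
  simp only [pow_two, Complex.add_re, Complex.sub_re, Complex.mul_re, Complex.add_im,
    Complex.sub_im, Complex.mul_im, Complex.conj_re, Complex.conj_im, Complex.ofReal_re,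
    Complex.ofReal_im, Complex.one_re, Complex.one_im, hA, hB]
  ring

/-- Every mode vanishes at B = 1, so each such point is a minimum and the tangential derivative
there is zero; this gives linear equations. A few sampled inequalities then leave only the zero
solution. -/
theorem cosine_coeffs_eq_zero {u1 u2 u3 u4 : ℝ}
    (U : ∀ x y X Y : ℝ, x ^ 2 + y ^ 2 = 1 → X ^ 2 + Y ^ 2 = 1 → 0 ≤
      u1 * (x + X - 1 - (x * X + y * Y))
      + u2 * (-2 * y * Y
          + 3 / 10 * ((x ^ 2 - y ^ 2) * (1 - (X ^ 2 - Y ^ 2)) - 2 * x * y * (2 * X * Y)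
            + X ^ 2 - Y ^ 2 - 1))
      + 3 / 10 * u3 * ((x ^ 2 - y ^ 2) * (X - (X ^ 2 - Y ^ 2)) - 2 * x * y * (Y + 2 * X * Y)
          + x * (X ^ 2 - Y ^ 2 - X) - y * (2 * X * Y + Y))
      - 9 / 100 * u4 * (2 * (2 * x * y) * (2 * X * Y))) :
    u1 = 0 ∧ u2 = 0 ∧ u3 = 0 ∧ u4 = 0 := by
  have circ : ∀ t : ℝ, ((1 - t ^ 2) / (1 + t ^ 2)) ^ 2 + (2 * t / (1 + t ^ 2)) ^ 2 = 1 := by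
    intro t
    have : (1 + t ^ 2) ≠ 0 := by positivity
    field_simp; ring
  -- Rational parametrization of B, with B = 1 at t = 0, and A = i; multiplying by (1+t²)² clears
  -- denominators. `k2` does the same at A = (3+4i)/5.
  have k1 : -2 * (u1 + 2 * u2 + 9 / 10 * u3) = 0 := by
    refine eq_zero_of_forall_quartic_nonneg (b := -2 * u1 - 24 / 5 * u2 - 9 / 5 * u3)
      (c := -2 * u1 - 4 * u2 + 3 / 5 * u3) (d := -2 * u1 + 3 / 5 * u3)
      fun t => ?_
    have h1 := U 0 1 _ _ (by norm_num) (circ t)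
    have hp : 0 < (1 + t ^ 2) := by positivity
    have h2 := mul_nonneg h1 (sq_nonneg (1 + t ^ 2))
    refine h2.trans_eq ?_
    field_simp
    ring
  have k2 : -8 / 5 * u1 - 544 / 125 * u2 - 396 / 125 * u3 - 432 / 625 * u4 = 0 := by
    refine eq_zero_of_forall_quartic_nonneg (b := -4 / 5 * u1 - 384 / 125 * u2 - 198 / 125 * u3)
      (c := -8 / 5 * u1 - 256 / 125 * u2 + 132 / 125 * u3 + 432 / 625 * u4)
      (d := -4 / 5 * u1 + 66 / 125 * u3) fun t => ?_
    have h1 := U (3 / 5) (4 / 5) _ _ (by norm_num) (circ t)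
    have hp : 0 < (1 + t ^ 2) := by positivity
    have h2 := mul_nonneg h1 (sq_nonneg (1 + t ^ 2))
    refine h2.trans_eq ?_
    field_simp
    ring
  -- Averaging over the fourth roots of unity A = ±1, ±i keeps only the terms of degree 0 in A,
  -- which occur in the first two modes alone.
  have S1 : ∀ X Y : ℝ, X ^ 2 + Y ^ 2 = 1 →
      0 ≤ u1 * (X - 1) + u2 * (3 / 10 * (X ^ 2 - Y ^ 2 - 1)) := by
    intro X Y hX
    have a := U 1 0 X Y (by norm_num) hX
    have b := U (-1) 0 X Y (by norm_num) hX
    have c := U 0 1 X Y (by norm_num) hX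
    have d := U 0 (-1) X Y (by norm_num) hX
    linarith
  have s1 := S1 (-1) 0 (by norm_num)
  have s2 := S1 (4 / 5) (3 / 5) (by norm_num)
  have t1 := U (4 / 5) (3 / 5) (4 / 5) (3 / 5) (by norm_num) (by norm_num)
  have t2 := U (4 / 5) (-3 / 5) (4 / 5) (3 / 5) (by norm_num) (by norm_num)
  norm_num at s1 s2 t1 t2
  have z1 : u1 = 0 := by linarith
  have z2 : u2 = 0 := by linarith
  have z3 : u3 = 0 := by linarith
  exact ⟨z1, z2, z3, by linarith⟩

/-- The same average over A isolates `v1` and `v2`; one further point each gives `v3` and `v4`. -/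
theorem sine_coeffs_eq_zero {v1 v2 v3 v4 : ℝ}
    (Z : ∀ x y X Y : ℝ, x ^ 2 + y ^ 2 = 1 → X ^ 2 + Y ^ 2 = 1 →
      v1 * (y + Y - (y * X - x * Y))
      + v2 * (2 * x * Y
          + 3 / 10 * ((x ^ 2 - y ^ 2) * (2 * X * Y) + 2 * x * y * (1 - (X ^ 2 - Y ^ 2))
            + 2 * X * Y))
      + 3 / 10 * v3 * ((x ^ 2 - y ^ 2) * (Y + 2 * X * Y) + 2 * x * y * (X - (X ^ 2 - Y ^ 2))
          + y * (X ^ 2 - Y ^ 2 - X) + x * (2 * X * Y + Y))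
      + 9 / 100 * v4 * (2 * (x ^ 2 - y ^ 2) * (2 * X * Y)) = 0) :
    v1 = 0 ∧ v2 = 0 ∧ v3 = 0 ∧ v4 = 0 := by
  have S2 : ∀ X Y : ℝ, X ^ 2 + Y ^ 2 = 1 → v1 * Y + v2 * (3 / 5 * X * Y) = 0 := by
    intro X Y hX
    have a := Z 1 0 X Y (by norm_num) hX
    have b := Z (-1) 0 X Y (by norm_num) hX
    have c := Z 0 1 X Y (by norm_num) hX
    have d := Z 0 (-1) X Y (by norm_num) hX
    linarith
  have y1 : v1 = 0 := by have := S2 0 1 (by norm_num); linarith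
  have y2 : v2 = 0 := by have := S2 (3 / 5) (4 / 5) (by norm_num); linarith
  have y3 : v3 = 0 := by have := Z 0 1 0 1 (by norm_num) (by norm_num); linarith
  have y4 : v4 = 0 := by have := Z 1 0 (3 / 5) (4 / 5) (by norm_num) (by norm_num); linarith
  exact ⟨y1, y2, y3, y4⟩

/-- No nontrivial linear functional is nonnegative on the limiting mode vectors. -/
theorem eq_zero_of_pairing_nonneg (μ : Fin 4 → ℂ)
    (h : ∀ A B : ℂ, ‖A‖ = 1 → ‖B‖ = 1 → 0 ≤ (∑ m, μ m * modeVec 0 A B m).re) : μ = 0 := by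
  have nrm : ∀ x y : ℝ, x ^ 2 + y ^ 2 = 1 → ‖(⟨x, y⟩ : ℂ)‖ = 1 := by
    intro x y hxy
    have := Complex.sq_norm ⟨x, y⟩
    rw [Complex.normSq_mk] at this
    have h2 : ‖(⟨x, y⟩ : ℂ)‖ ^ 2 = 1 := by rw [this]; linarith
    nlinarith [norm_nonneg (⟨x, y⟩ : ℂ)]
  have H := fun (x y X Y : ℝ) (h1 : x ^ 2 + y ^ 2 = 1) (h2 : X ^ 2 + Y ^ 2 = 1) =>
    (h _ _ (nrm x y h1) (nrm X Y h2)).trans_eq (modeVec_pairing_re μ x y X Y h2)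
  -- Adding the inequalities at (A, B) and at the conjugate pair cancels the imaginary parts of `μ`.
  have hu := cosine_coeffs_eq_zero (u1 := (μ 0).re) (u2 := (μ 1).re) (u3 := (μ 2).re)
    (u4 := (μ 3).re) (by
    intro x y X Y h1 h2
    have a := H x y X Y h1 h2
    have b := H x (-y) X (-Y) (by linarith) (by linarith)
    linarith)
  obtain ⟨z1, z2, z3, z4⟩ := hu
  -- With the real parts gone the pairing is odd under conjugation, so nonnegativity forces it to
  -- vanish identically.
  have hv := sine_coeffs_eq_zero (v1 := (μ 0).im) (v2 := (μ 1).im) (v3 := (μ 2).im)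
    (v4 := (μ 3).im) (by
    intro x y X Y h1 h2
    have a := H x y X Y h1 h2
    have b := H x (-y) X (-Y) (by linarith) (by linarith)
    rw [z1, z2, z3, z4] at a b
    linarith)
  obtain ⟨y1, y2, y3, y4⟩ := hv
  funext m
  fin_cases m <;> apply Complex.ext <;> assumption

/-! ### High frequencies decouple the two phases -/

/-- The unimodular number `s^{iω}`. -/
noncomputable def phase (ω s : ℝ) : ℂ := Complex.exp ((ω * Real.log s : ℝ) * Complex.I)

/-- At s ≈ τ/ω the second phase tends to e^(-iτ), which can be any unit number. Changing s by a
factor 1 + O(1/ω) turns the first phase through a full circle without affecting that limit, so the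
first phase can be matched exactly. -/
theorem exists_scaling_sequence {A B : ℂ} (hA : ‖A‖ = 1) (hB : ‖B‖ = 1) :
    ∃ s : ℕ → ℝ, (∀ᶠ n in atTop, s n ∈ Ioo (0 : ℝ) 1) ∧ Tendsto s atTop (𝓝 0) ∧
      (∀ n : ℕ, phase (n + 1) (s n) = A) ∧
      Tendsto (fun n : ℕ => phase (n + 1) (1 - s n)) atTop (𝓝 B) := by
  have expA : Complex.exp (A.arg * Complex.I) = A := by
    have := Complex.norm_mul_exp_arg_mul_I A
    rwa [hA, Complex.ofReal_one, one_mul] at this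
  have expB : Complex.exp (B.arg * Complex.I) = B := by
    have := Complex.norm_mul_exp_arg_mul_I B
    rwa [hB, Complex.ofReal_one, one_mul] at this
  have pi := Real.pi_pos
  -- Shifting by 2π makes τ positive, as s > 0 requires, while e^(-iτ) is still B.
  obtain ⟨τ, hτ⟩ : ∃ τ, τ = 2 * Real.pi - B.arg := ⟨_, rfl⟩
  have τpos : 0 < τ := by have := Complex.arg_le_pi B; linarith
  -- The branch of the argument of A that brings s closest to τ/(n+1) from below: the logarithmic
  -- error `e n` lies in (-2π/(n+1), 0].
  let k : ℕ → ℤ := fun n => ⌈(A.arg - (n + 1) * Real.log (τ / (n + 1))) / (2 * Real.pi)⌉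
  let e : ℕ → ℝ := fun n =>
    (A.arg - (n + 1) * Real.log (τ / (n + 1)) - 2 * Real.pi * k n) / (n + 1)
  let s : ℕ → ℝ := fun n => Real.exp ((A.arg - 2 * Real.pi * k n) / (n + 1))
  have ωpos : ∀ n : ℕ, (0 : ℝ) < n + 1 := fun n => by positivity
  have se : ∀ n : ℕ, (n + 1) * s n = τ * Real.exp (e n) := by
    intro n
    have h1 : (A.arg - 2 * Real.pi * k n) / (n + 1) = Real.log (τ / (n + 1)) + e n := by
      have := (ωpos n).ne'
      simp only [e]; field_simp; ring
    simp only [s]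
    rw [h1, Real.exp_add, Real.exp_log (div_pos τpos (ωpos n))]
    field_simp
  have ωtop : Tendsto (fun n : ℕ => (n : ℝ) + 1) atTop atTop :=
    tendsto_atTop_add_const_right _ _ tendsto_natCast_atTop_atTop
  have e0 : Tendsto e atTop (𝓝 0) := by
    have hlow : Tendsto (fun n : ℕ => -(2 * Real.pi) / ((n : ℝ) + 1)) atTop (𝓝 0) :=
      tendsto_const_nhds.div_atTop ωtop
    refine tendsto_of_tendsto_of_tendsto_of_le_of_le hlow tendsto_const_nhds
      (fun n => ?_) (fun n => ?_)
    · have := Int.ceil_lt_add_one ((A.arg - (n + 1) * Real.log (τ / (n + 1))) / (2 * Real.pi))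
      rw [← sub_lt_iff_lt_add, lt_div_iff₀ (by positivity)] at this
      refine div_le_div_of_nonneg_right ?_ (ωpos n).le
      simp only [k]
      linarith
    · have := Int.le_ceil ((A.arg - (n + 1) * Real.log (τ / (n + 1))) / (2 * Real.pi))
      rw [div_le_iff₀ (by positivity)] at this
      refine div_nonpos_of_nonpos_of_nonneg ?_ (ωpos n).le
      simp only [k]
      linarith
  have ωs : Tendsto (fun n : ℕ => ((n : ℝ) + 1) * s n) atTop (𝓝 τ) := by
    simp_rw [se]
    have := ((Real.continuous_exp.tendsto 0).comp e0).const_mul τ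
    simpa using this
  have s0 : Tendsto s atTop (𝓝 0) := by
    have := ωs.div_atTop ωtop
    refine this.congr fun n => ?_
    have := (ωpos n).ne'
    field_simp
  have spos : ∀ n, 0 < s n := fun n => Real.exp_pos _
  have slt : ∀ᶠ n in atTop, s n < 1 := s0.eventually (gt_mem_nhds one_pos)
  have lim : Tendsto (fun n : ℕ => ((n : ℝ) + 1) * Real.log (1 - s n)) atTop (𝓝 (-τ)) := by
    have h1 : Tendsto (fun n : ℕ => -(((n : ℝ) + 1) * s n) / (1 - s n)) atTop (𝓝 (-τ)) := by
      have := ωs.neg.div (s0.const_sub 1) (by norm_num)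
      rw [sub_zero, div_one] at this
      exact this
    refine tendsto_of_tendsto_of_tendsto_of_le_of_le' h1 ωs.neg ?_ ?_
    · filter_upwards [slt] with n hn
      have h2 : 0 < 1 - s n := by linarith
      have := mul_le_mul_of_nonneg_left (Real.one_sub_inv_le_log_of_pos h2) (ωpos n).le
      refine le_trans (le_of_eq ?_) this
      field_simp
      ring
    · filter_upwards [slt] with n hn
      have h2 : 0 < 1 - s n := by linarith
      have := mul_le_mul_of_nonneg_left (Real.log_le_sub_one_of_pos h2) (ωpos n).le
      linarith
  refine ⟨s, ?_, s0, fun n => ?_, ?_⟩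
  · filter_upwards [slt] with n hn using ⟨spos n, hn⟩
  · have h1 : ((n : ℝ) + 1) * Real.log (s n) = A.arg - 2 * Real.pi * k n := by
      simp only [s, Real.log_exp]
      have := (ωpos n).ne'
      field_simp
    rw [phase, h1]
    conv_rhs => rw [← expA]
    rw [Complex.exp_eq_exp_iff_exists_int]
    exact ⟨-k n, by push_cast; ring⟩
  · have h1 : B = Complex.exp (((-τ : ℝ) : ℂ) * Complex.I) := by
      conv_lhs => rw [← expB]
      rw [Complex.exp_eq_exp_iff_exists_int]
      exact ⟨1, by rw [hτ]; push_cast; ring⟩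
    rw [h1]
    have hc : Continuous fun θ : ℝ => Complex.exp ((θ : ℂ) * Complex.I) := by fun_prop
    exact (hc.tendsto (-τ)).comp lim

theorem continuous_modeVec (m : Fin 4) :
    Continuous fun q : ℝ × ℂ × ℂ => modeVec q.1 q.2.1 q.2.2 m := by
  have hc := Complex.continuous_conj
  have h1 : Continuous fun q : ℝ × ℂ × ℂ => conj q.2.1 := hc.comp (by fun_prop)
  have h2 : Continuous fun q : ℝ × ℂ × ℂ => conj q.2.2 := hc.comp (by fun_prop)
  have h3 : Continuous fun q : ℝ × ℂ × ℂ => pairCoeff q.2.1 q.2.2 m := by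
    fin_cases m <;> simp [pairCoeff] <;> fun_prop
  unfold modeVec
  fun_prop

/-- For a suitable frequency, no nontrivial linear functional is nonnegative along the curve of
mode vectors. -/
theorem exists_frequency : ∃ ω : ℝ, 0 < ω ∧ ∀ μ : Fin 4 → ℂ,
    (∀ s ∈ Ioo (0 : ℝ) 1,
      0 ≤ (∑ m, μ m * modeVec s (phase ω s) (phase ω (1 - s)) m).re) → μ = 0 := by
  -- Counterexamples at the frequencies n+1, normalized to the unit sphere, have a convergent
  -- subsequence; its limit is a forbidden nonzero functional.
  by_contra! hcon
  have h1 : ∀ n : ℕ, ∃ μ : Fin 4 → ℂ, μ ∈ Metric.sphere (0 : Fin 4 → ℂ) 1 ∧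
      ∀ s ∈ Ioo (0 : ℝ) 1, 0 ≤ (∑ m, μ m *
        modeVec s (phase (n + 1) s) (phase (n + 1) (1 - s)) m).re := by
    intro n
    obtain ⟨μ, hμ, hne⟩ := hcon (n + 1) (by positivity)
    have hn : 0 < ‖μ‖ := norm_pos_iff.2 hne
    refine ⟨(‖μ‖⁻¹ : ℝ) • μ, ?_, fun s hs => ?_⟩
    · rw [mem_sphere_zero_iff_norm, norm_smul, Real.norm_of_nonneg (by positivity)]
      field_simp
    · have h2 := mul_nonneg (inv_nonneg.2 hn.le) (hμ s hs)
      rw [← Complex.re_ofReal_mul, Finset.mul_sum] at h2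
      simpa only [Pi.smul_apply, Complex.real_smul, mul_assoc] using h2
  choose μ hμ1 hμ2 using h1
  obtain ⟨ν, hν, φ, hφ, hlim⟩ := (isCompact_sphere (0 : Fin 4 → ℂ) 1).tendsto_subseq hμ1
  have hz : ν = 0 := by
    refine eq_zero_of_pairing_nonneg ν fun A B hA hB => ?_
    obtain ⟨s, hs, hs0, hsA, hsB⟩ := exists_scaling_sequence hA hB
    have hcont : Continuous fun q : (Fin 4 → ℂ) × ℝ × ℂ × ℂ =>
        (∑ m, q.1 m * modeVec q.2.1 q.2.2.1 q.2.2.2 m).re := by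
      refine Complex.continuous_re.comp (continuous_finsetSum _ fun m _ => ?_)
      exact ((continuous_apply m).comp continuous_fst).mul
        ((continuous_modeVec m).comp continuous_snd)
    have ht : Tendsto (fun n => (μ (φ n), s (φ n), phase ((φ n : ℕ) + 1) (s (φ n)),
        phase ((φ n : ℕ) + 1) (1 - s (φ n)))) atTop (𝓝 (ν, 0, A, B)) := by
      refine hlim.prodMk_nhds ((hs0.comp hφ.tendsto_atTop).prodMk_nhds
        (Tendsto.prodMk_nhds ?_ (hsB.comp hφ.tendsto_atTop)))
      simp_rw [hsA]
      exact tendsto_const_nhds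
    refine ge_of_tendsto ((hcont.tendsto _).comp ht) ?_
    filter_upwards [hφ.tendsto_atTop.eventually hs] with n hn
    exact hμ2 (φ n) (s (φ n)) hn
  rw [hz] at hν
  simp at hν

/-! ### Symmetric bumps and their moment cone -/

/-- The affine span is closed, hence everything, so the set has nonempty interior; a convex set with
interior points has the same interior as its closure. This turns density of the moment cone into
exact realizability. -/
theorem eq_univ_of_convex_of_dense {E : Type*} [NormedAddCommGroup E] [NormedSpace ℝ E]
    [FiniteDimensional ℝ E] {C : Set E} (hC : Convex ℝ C) (hd : Dense C) : C = univ := by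
  have h1 : affineSpan ℝ C = ⊤ := by
    have hcl : IsClosed (affineSpan ℝ C : Set E) := (affineSpan ℝ C).closed_of_finiteDimensional
    have : (affineSpan ℝ C : Set E) = univ :=
      univ_subset_iff.1 (hd.closure_eq ▸ closure_minimal (subset_affineSpan ℝ C) hcl)
    exact SetLike.coe_injective (by rw [this]; rfl)
  have h2 : (interior C).Nonempty := hC.interior_nonempty_iff_affineSpan_eq_top.2 h1
  have h3 := hC.interior_closure_eq_interior_of_nonempty_interior h2
  rw [hd.closure_eq, interior_univ] at h3
  exact univ_subset_iff.1 (h3 ▸ interior_subset)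

/-- Continuous functions with compact support in `(0,1)` that are symmetric about `1/2`. -/
structure IsSymmBump (h : ℝ → ℝ) : Prop where
  continuous : Continuous h
  symm : ∀ s, h (1 - s) = h s
  support : ∃ η : ℝ, 0 < η ∧ ∀ s, s ∉ Icc η (1 - η) → h s = 0

theorem IsSymmBump.add {h k : ℝ → ℝ} (hh : IsSymmBump h) (hk : IsSymmBump k) :
    IsSymmBump (fun s => h s + k s) := by
  refine ⟨hh.continuous.add hk.continuous, fun s => by rw [hh.symm, hk.symm], ?_⟩
  obtain ⟨a, ha, hha⟩ := hh.support
  obtain ⟨b, hb, hkb⟩ := hk.support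
  refine ⟨min a b, lt_min ha hb, fun s hs => ?_⟩
  have h1 := min_le_left a b
  have h2 := min_le_right a b
  rw [hha s fun h => hs ⟨h1.trans h.1, h.2.trans (by linarith)⟩,
    hkb s fun h => hs ⟨h2.trans h.1, h.2.trans (by linarith)⟩, add_zero]

theorem IsSymmBump.const_mul {h : ℝ → ℝ} (hh : IsSymmBump h) (c : ℝ) :
    IsSymmBump (fun s => c * h s) := by
  refine ⟨hh.continuous.const_mul c, fun s => by rw [hh.symm], ?_⟩
  obtain ⟨a, ha, hha⟩ := hh.support
  exact ⟨a, ha, fun s hs => by rw [hha s hs, mul_zero]⟩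

theorem IsSymmBump.integrableOn_mul {h : ℝ → ℝ} (hh : IsSymmBump h) {c : ℝ → ℂ}
    (hc : ContinuousOn c (Ioo 0 1)) :
    IntegrableOn (fun s => (h s : ℂ) * c s) (Ioo 0 1) := by
  obtain ⟨a, ha, hha⟩ := hh.support
  have hsub : Icc a (1 - a) ⊆ Ioo 0 1 := fun s hs => ⟨by linarith [hs.1], by linarith [hs.2]⟩
  have h1 : IntegrableOn (fun s => (h s : ℂ) * c s) (Icc a (1 - a)) := by
    refine ContinuousOn.integrableOn_compact isCompact_Icc ?_
    exact (Complex.continuous_ofReal.comp hh.continuous).continuousOn.mul (hc.mono hsub)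
  refine h1.of_forall_sdiff_eq_zero measurableSet_Ioo fun s hs => ?_
  rw [hha s hs.2, Complex.ofReal_zero, zero_mul]

/-- Where φ is negative, a small tent together with its mirror image would have a strictly negative
integral against φ. -/
theorem nonneg_of_forall_bump_integral_nonneg {φ : ℝ → ℝ} (hφ : ContinuousOn φ (Ioo 0 1))
    (hsymm : ∀ s, φ (1 - s) = φ s)
    (H : ∀ h, IsSymmBump h → (∀ s, 0 ≤ h s) → 0 ≤ ∫ s in Ioo (0 : ℝ) 1, h s * φ s) :
    ∀ s ∈ Ioo (0 : ℝ) 1, 0 ≤ φ s := by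
  intro s₀ hs₀
  by_contra! hneg
  have hev : ∀ᶠ s in 𝓝 s₀, s ∈ Ioo (0 : ℝ) 1 ∧ φ s < 0 := by
    have hn := Ioo_mem_nhds hs₀.1 hs₀.2
    exact (eventually_of_mem hn fun s hs => hs).and
      ((hφ.continuousAt hn).eventually (gt_mem_nhds hneg))
  obtain ⟨r, hr, hball⟩ := Metric.eventually_nhds_iff.1 hev
  obtain ⟨η, hη, hηr, hη0, hη1⟩ : ∃ η > 0, η ≤ r ∧ 2 * η ≤ s₀ ∧ 2 * η ≤ 1 - s₀ := by
    refine ⟨min r (min (s₀ / 2) ((1 - s₀) / 2)), ?_, min_le_left _ _, ?_, ?_⟩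
    · have := hs₀.1; have := hs₀.2
      exact lt_min hr (lt_min (by linarith) (by linarith))
    · have := (min_le_right r (min (s₀ / 2) ((1 - s₀) / 2))).trans (min_le_left _ _)
      linarith
    · have := (min_le_right r (min (s₀ / 2) ((1 - s₀) / 2))).trans (min_le_right _ _)
      linarith
  let k : ℝ → ℝ := fun s => max 0 (η - |s - s₀|)
  have k0 : ∀ s, 0 ≤ k s := fun s => le_max_left _ _
  have kz : ∀ s, k s ≠ 0 → |s - s₀| < η := by
    intro s hs
    by_contra! hle
    exact hs (max_eq_left (by linarith))
  have kneg : ∀ s, k s * φ s ≤ 0 := by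
    intro s
    by_cases hs : k s = 0
    · simp [hs]
    · exact mul_nonpos_of_nonneg_of_nonpos (k0 s) (hball ((kz s hs).trans_le hηr)).2.le
  have hb : IsSymmBump (fun s => k s + k (1 - s)) := by
    refine ⟨by fun_prop, fun s => by rw [sub_sub_cancel, add_comm], η, hη, fun s hs => ?_⟩
    have e1 : k s = 0 := by
      by_contra hne
      have := abs_lt.1 (kz s hne)
      exact hs ⟨by linarith, by linarith⟩
    have e2 : k (1 - s) = 0 := by
      by_contra hne
      have := abs_lt.1 (kz _ hne)
      exact hs ⟨by linarith, by linarith⟩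
    rw [e1, e2, add_zero]
  have hle : ∀ s, (k s + k (1 - s)) * φ s ≤ 0 := by
    intro s
    have h1 := kneg s
    have h2 := kneg (1 - s)
    rw [hsymm] at h2
    linarith
  have hint : IntegrableOn (fun s => (k s + k (1 - s)) * φ s) (Ioo 0 1) := by
    have := (hb.integrableOn_mul (c := fun s => (φ s : ℂ))
      (Complex.continuous_ofReal.comp_continuousOn hφ)).re
    refine this.congr (Eventually.of_forall fun s => ?_)
    simp
  have hzero : ∫ s in Ioo (0 : ℝ) 1, (k s + k (1 - s)) * φ s = 0 :=
    le_antisymm (integral_nonpos hle) (H _ hb fun s => add_nonneg (k0 s) (k0 _))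
  have hae : (fun s => -((k s + k (1 - s)) * φ s)) =ᵐ[volume.restrict (Ioo 0 1)] 0 := by
    refine (integral_eq_zero_iff_of_nonneg (fun s => ?_) hint.neg).1 ?_
    · simpa using hle s
    · simp only [Pi.neg_apply]
      rw [integral_neg, hzero, neg_zero]
  have heq := Measure.eqOn_open_of_ae_eq hae isOpen_Ioo
    ((hb.continuous.continuousOn.mul hφ).neg) continuousOn_const hs₀
  have hk : k s₀ = η := by simp [k, hη.le]
  simp only [Pi.zero_apply, neg_eq_zero, mul_eq_zero, hk, hneg.ne, or_false] at heq
  linarith [k0 (1 - s₀)]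

theorem continuousOn_phase (ω : ℝ) : ContinuousOn (phase ω) (Ioi 0) := by
  have h1 : ContinuousOn (fun s : ℝ => ω * Real.log s) (Ioi 0) :=
    continuousOn_const.mul (Real.continuousOn_log.mono fun s hs => ne_of_gt hs)
  have h2 : Continuous fun t : ℝ => Complex.exp ((t : ℂ) * Complex.I) := by fun_prop
  exact h2.comp_continuousOn h1

theorem continuousOn_phase_left (ω : ℝ) : ContinuousOn (phase ω) (Ioo 0 1) :=
  (continuousOn_phase ω).mono fun _ hs => hs.1

theorem continuousOn_phase_right (ω : ℝ) :
    ContinuousOn (fun s => phase ω (1 - s)) (Ioo 0 1) :=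
  (continuousOn_phase ω).comp (by fun_prop) fun s hs => sub_pos.2 hs.2

/-- The curve of mode vectors for the frequency `ω`. -/
noncomputable def modeCurve (ω s : ℝ) : Fin 4 → ℂ := modeVec s (phase ω s) (phase ω (1 - s))

theorem continuousOn_modeCurve (ω : ℝ) (m : Fin 4) :
    ContinuousOn (fun s => modeCurve ω s m) (Ioo 0 1) := by
  have h1 : ContinuousOn (fun s : ℝ => (s, phase ω s, phase ω (1 - s))) (Ioo 0 1) :=
    continuousOn_id.prodMk ((continuousOn_phase_left ω).prodMk (continuousOn_phase_right ω))
  exact ((continuous_modeVec m).comp_continuousOn h1).congr fun s _ => rfl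

theorem pairCoeff_comm (A B : ℂ) (m : Fin 4) : pairCoeff A B m = pairCoeff B A m := by
  fin_cases m <;> simp [pairCoeff] <;> ring

theorem modeCurve_symm (ω s : ℝ) (m : Fin 4) : modeCurve ω (1 - s) m = modeCurve ω s m := by
  simp only [modeCurve, modeVec, sub_sub_cancel]
  rw [pairCoeff_comm]
  push_cast
  ring

/-- The moments of a weight against the mode curve. -/
noncomputable def modeIntegral (ω : ℝ) (w : ℝ → ℝ) (m : Fin 4) : ℂ :=
  ∫ s in Ioo (0 : ℝ) 1, (w s : ℂ) * modeCurve ω s m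

theorem modeIntegral_linear (ω : ℝ) {h k : ℝ → ℝ}
    (hh : ∀ m, IntegrableOn (fun s => (h s : ℂ) * modeCurve ω s m) (Ioo 0 1))
    (hk : ∀ m, IntegrableOn (fun s => (k s : ℂ) * modeCurve ω s m) (Ioo 0 1)) (a b : ℝ) :
    modeIntegral ω (fun s => a * h s + b * k s) = a • modeIntegral ω h + b • modeIntegral ω k := by
  funext m
  simp only [modeIntegral, Pi.add_apply, Pi.smul_apply, Complex.real_smul]
  rw [← integral_const_mul, ← integral_const_mul, ← integral_add]
  · congr 1
    funext s
    push_cast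
    ring
  · exact (hh m).const_mul _
  · exact (hk m).const_mul _

/-- For a suitable frequency, nonnegative symmetric bumps realize every vector of moments. -/
theorem exists_frequency_forall_bump : ∃ ω : ℝ, 0 < ω ∧ ∀ v : Fin 4 → ℂ,
    ∃ h, IsSymmBump h ∧ (∀ s, 0 ≤ h s) ∧ modeIntegral ω h = v := by
  obtain ⟨ω, hω, key⟩ := exists_frequency
  refine ⟨ω, hω, ?_⟩
  let C : Set (Fin 4 → ℂ) := {v | ∃ h, IsSymmBump h ∧ (∀ s, 0 ≤ h s) ∧ modeIntegral ω h = v}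
  have hintg : ∀ h, IsSymmBump h →
      ∀ m, IntegrableOn (fun s => (h s : ℂ) * modeCurve ω s m) (Ioo 0 1) :=
    fun h hh m => hh.integrableOn_mul (continuousOn_modeCurve ω m)
  have hcone : ∀ v ∈ C, ∀ w ∈ C, ∀ a b : ℝ, 0 ≤ a → 0 ≤ b → a • v + b • w ∈ C := by
    rintro _ ⟨h, hh, h0, rfl⟩ _ ⟨k, hk, k0, rfl⟩ a b ha hb
    exact ⟨fun s => a * h s + b * k s, (hh.const_mul a).add (hk.const_mul b),
      fun s => add_nonneg (mul_nonneg ha (h0 s)) (mul_nonneg hb (k0 s)),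
      modeIntegral_linear ω (hintg h hh) (hintg k hk) a b⟩
  have hconv : Convex ℝ C := fun v hv w hw a b ha hb _ => hcone v hv w hw a b ha hb
  have zmem : (0 : Fin 4 → ℂ) ∈ C :=
    ⟨fun _ => 0, ⟨continuous_const, fun _ => rfl, 1, one_pos, fun _ _ => rfl⟩, fun _ => le_rfl, by
      funext m; simp [modeIntegral]⟩
  suffices hC : C = univ by
    intro v
    have : v ∈ C := hC ▸ mem_univ v
    exact this
  refine eq_univ_of_convex_of_dense hconv ?_
  intro v
  by_contra hv
  obtain ⟨f, u, hfu, huv⟩ := geometric_hahn_banach_closed_point hconv.closure isClosed_closure hv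
  have hu : 0 < u := by simpa using hfu 0 (subset_closure zmem)
  -- A functional bounded above on a cone is nonpositive there: a positive value could be rescaled
  -- to equal the bound `u`.
  have hf : ∀ w ∈ C, f w ≤ 0 := by
    intro w hw
    by_contra! hpos
    have h1 := hfu _ (subset_closure (hcone w hw w hw (u / f w) 0 (by positivity) le_rfl))
    simp only [zero_smul, add_zero, map_smul, smul_eq_mul] at h1
    rw [div_mul_cancel₀ _ hpos.ne'] at h1
    exact lt_irrefl _ h1
  -- Complex coordinates of the real functional -f, for the pairing Re Σ μₘ wₘ.
  let μ : Fin 4 → ℂ := fun m => ⟨-f (Pi.single m 1), f (Pi.single m Complex.I)⟩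
  have hrep : ∀ w : Fin 4 → ℂ, -f w = (∑ m, μ m * w m).re := by
    intro w
    have h1 : w = ∑ m, ((w m).re • (Pi.single m 1 : Fin 4 → ℂ)
        + (w m).im • (Pi.single m Complex.I : Fin 4 → ℂ)) := by
      funext j
      simp only [Finset.sum_apply, Pi.add_apply, Pi.smul_apply, Pi.single_apply]
      simp only [smul_ite, smul_zero]
      rw [Finset.sum_add_distrib]
      simp
    conv_lhs => rw [h1]
    rw [map_sum, ← Finset.sum_neg_distrib, Complex.re_sum]
    refine Finset.sum_congr rfl fun m _ => ?_
    simp [μ]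
    ring
  have hμ : μ = 0 := by
    refine key μ ?_
    have hcont : ContinuousOn (fun s => ∑ m, μ m * modeCurve ω s m) (Ioo 0 1) :=
      continuousOn_finsetSum _ fun m _ => continuousOn_const.mul (continuousOn_modeCurve ω m)
    refine nonneg_of_forall_bump_integral_nonneg
      (φ := fun s => (∑ m, μ m * modeCurve ω s m).re)
      (Complex.continuous_re.comp_continuousOn hcont) (fun s => by simp_rw [modeCurve_symm])
      fun h hh h0 => ?_
    have h1 := hf _ ⟨h, hh, h0, rfl⟩
    rw [← neg_nonneg, hrep] at h1
    refine h1.trans_eq ?_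
    have h2 : ∑ m, μ m * modeIntegral ω h m
        = ∫ s in Ioo (0 : ℝ) 1, (h s : ℂ) * ∑ m, μ m * modeCurve ω s m := by
      simp only [modeIntegral]
      simp_rw [← integral_const_mul, Finset.mul_sum]
      rw [integral_finsetSum]
      · refine Finset.sum_congr rfl fun m _ => ?_
        congr 1
        funext s
        ring
      · intro m _
        refine ((hintg h hh m).const_mul (μ m)).congr (Eventually.of_forall fun s => ?_)
        simp only
        ring
    have h3 : IntegrableOn (fun s => (h s : ℂ) * ∑ m, μ m * modeCurve ω s m) (Ioo 0 1) :=
      hh.integrableOn_mul hcont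
    rw [h2]
    refine (integral_re h3).symm.trans ?_
    simp
  have : f v = 0 := by
    have := hrep v
    rw [hμ] at this
    simpa using this
  linarith

/-! ### The flux in the variables s = y/(y+z) and log y -/

/-- Change of variables `z = y/s - y`, i.e. `s = y/(y+z)`, in the flux integral. -/
theorem lintegral_flux_region_eq {H : ℝ → ℝ → ℝ≥0∞} (hH : Measurable (Function.uncurry H))
    {x : ℝ} (hx : 0 < x) :
    ∫⁻ y in Ioo 0 x, ∫⁻ z in Ioi (x - y), H y z =
      ∫⁻ s in Ioo (0 : ℝ) 1, ∫⁻ y in Ioo (s * x) x,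
        ENNReal.ofReal (y / s ^ 2) * H y (y / s - y) := by
  have inner : ∀ y ∈ Ioo 0 x, ∫⁻ z in Ioi (x - y), H y z =
      ∫⁻ s in Ioo 0 (y / x), ENNReal.ofReal (y / s ^ 2) * H y (y / s - y) := by
    intro y hy
    -- The condition y + z > x reads s < y/x; after the exchange of integrals, y runs over (sx, x).
    have himg : (fun s => y / s - y) '' Ioo 0 (y / x) = Ioi (x - y) := by
      ext z
      constructor
      · rintro ⟨s, hs, rfl⟩
        have h1 : x < y / s := by
          rw [lt_div_iff₀ hs.1]
          have := (lt_div_iff₀ hx).1 hs.2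
          linarith
        simp only [mem_Ioi]
        linarith
      · intro hz
        have hz' : x < y + z := by simp only [mem_Ioi] at hz; linarith
        have hpos : 0 < y + z := hx.trans hz'
        refine ⟨y / (y + z), ⟨div_pos hy.1 hpos, div_lt_div_of_pos_left hy.1 hx hz'⟩, ?_⟩
        have := hy.1.ne'
        have := hpos.ne'
        field_simp
        ring
    have hder : ∀ s ∈ Ioo 0 (y / x),
        HasDerivWithinAt (fun s => y / s - y) (-y / s ^ 2) (Ioo 0 (y / x)) s := by
      intro s hs
      have h1 := ((hasDerivAt_inv hs.1.ne').const_mul y).sub_const y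
      refine HasDerivAt.hasDerivWithinAt ?_
      refine (h1.congr_deriv ?_).congr_of_eventuallyEq (Eventually.of_forall fun t => ?_)
      · field_simp
      · simp [div_eq_mul_inv]
    have hinj : InjOn (fun s => y / s - y) (Ioo 0 (y / x)) := by
      intro a ha b hb hab
      have h1 : y / a = y / b := by simpa using hab
      have := hy.1.ne'
      have := ha.1.ne'
      have := hb.1.ne'
      field_simp at h1
      exact h1.symm
    rw [← himg, lintegral_image_eq_lintegral_abs_deriv_mul measurableSet_Ioo hder hinj]
    refine setLIntegral_congr_fun measurableSet_Ioo fun s _ => ?_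
    rw [abs_div, abs_neg, abs_of_pos hy.1, abs_of_nonneg (sq_nonneg s)]
  rw [setLIntegral_congr_fun measurableSet_Ioo inner]
  let F : ℝ → ℝ → ℝ≥0∞ := fun y s => ENNReal.ofReal (y / s ^ 2) * H y (y / s - y)
  let D : Set (ℝ × ℝ) := {q | 0 < q.1 ∧ q.1 < x ∧ 0 < q.2 ∧ q.2 < q.1 / x}
  have hF : Measurable (Function.uncurry F) := by
    have h1 : Measurable fun q : ℝ × ℝ => (q.1, q.1 / q.2 - q.1) := by fun_prop
    have h2 := hH.comp h1
    have h3 : Measurable fun q : ℝ × ℝ => ENNReal.ofReal (q.1 / q.2 ^ 2) := by fun_prop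
    exact h3.mul h2
  have hD : MeasurableSet D := by
    refine (measurableSet_lt measurable_const measurable_fst).inter
      ((measurableSet_lt measurable_fst measurable_const).inter
      ((measurableSet_lt measurable_const measurable_snd).inter
      (measurableSet_lt measurable_snd (by fun_prop))))
  have swap := lintegral_lintegral_swap (μ := (volume : Measure ℝ)) (ν := (volume : Measure ℝ))
    (f := fun y s => D.indicator (Function.uncurry F) (y, s)) (hF.indicator hD).aemeasurable
  have e1 : ∀ y, ∫⁻ s, D.indicator (Function.uncurry F) (y, s)
      = (Ioo 0 x).indicator (fun y => ∫⁻ s in Ioo 0 (y / x), F y s) y := by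
    intro y
    by_cases hy : y ∈ Ioo 0 x
    · rw [indicator_of_mem hy, ← lintegral_indicator measurableSet_Ioo]
      congr 1
      funext s
      by_cases hs : s ∈ Ioo 0 (y / x)
      · rw [indicator_of_mem hs, indicator_of_mem (show (y, s) ∈ D from ⟨hy.1, hy.2, hs.1, hs.2⟩)]
        rfl
      · rw [indicator_of_notMem hs, indicator_of_notMem]
        exact fun h => hs ⟨h.2.2.1, h.2.2.2⟩
    · rw [indicator_of_notMem hy]
      refine (lintegral_congr fun s => ?_).trans lintegral_zero
      exact indicator_of_notMem (fun h => hy ⟨h.1, h.2.1⟩) _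
  have e2 : ∀ s, ∫⁻ y, D.indicator (Function.uncurry F) (y, s)
      = (Ioo (0 : ℝ) 1).indicator (fun s => ∫⁻ y in Ioo (s * x) x, F y s) s := by
    intro s
    by_cases hs : s ∈ Ioo (0 : ℝ) 1
    · rw [indicator_of_mem hs, ← lintegral_indicator measurableSet_Ioo]
      congr 1
      funext y
      by_cases hy : y ∈ Ioo (s * x) x
      · rw [indicator_of_mem hy, indicator_of_mem]
        · rfl
        · exact ⟨(mul_pos hs.1 hx).trans hy.1, hy.2, hs.1, (lt_div_iff₀ hx).2 hy.1⟩
      · rw [indicator_of_notMem hy, indicator_of_notMem]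
        exact fun h => hy ⟨(lt_div_iff₀ hx).1 h.2.2.2, h.2.1⟩
    · rw [indicator_of_notMem hs]
      refine (lintegral_congr fun y => ?_).trans lintegral_zero
      refine indicator_of_notMem (fun h => hs ⟨h.2.2.1, h.2.2.2.trans ?_⟩) _
      exact (div_lt_one hx).2 h.2.1
  simp_rw [e1, e2] at swap
  rwa [lintegral_indicator measurableSet_Ioo, lintegral_indicator measurableSet_Ioo] at swap

/-- The homogeneous kernel with angular part `w(s) (s(1-s))^{(γ+3)/2}`. -/
noncomputable def weightKernel (γ : ℝ) (w : ℝ → ℝ) (x y : ℝ) : ℝ :=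
  (x + y) ^ γ * (w (x / (x + y)) * (x / (x + y) * (1 - x / (x + y))) ^ ((γ + 3) / 2))

/-- With r = y + z one has y = rs and z = r(1-s). The factor (s(1-s))^((γ+3)/2) of the kernel
cancels the power laws of f, and the remaining powers of r combine to the scale-invariant measure
dy/y. -/
theorem weightKernel_integrand_eq (γ C : ℝ) (w g : ℝ → ℝ) {s y : ℝ} (hs : s ∈ Ioo (0 : ℝ) 1)
    (hy : 0 < y) :
    y / s ^ 2 * (weightKernel γ w y (y / s - y) * y * (C * y ^ (-((γ + 3) / 2)) * g (Real.log y))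
        * (C * (y / s - y) ^ (-((γ + 3) / 2)) * g (Real.log (y / s - y)))) =
      C ^ 2 * (w s * s) *
        (1 / y * (g (Real.log y - Real.log s + Real.log s)
          * g (Real.log y - Real.log s + Real.log (1 - s)))) := by
  obtain ⟨r, hr⟩ : ∃ r, r = y / s := ⟨_, rfl⟩
  have hrpos : 0 < r := hr ▸ div_pos hy hs.1
  have s0 := hs.1
  have s1 : 0 < 1 - s := sub_pos.2 hs.2
  have hyr : y = r * s := by rw [hr]; field_simp
  have hz : y / s - y = r * (1 - s) := by rw [← hr, hyr]; ring
  have hlz : Real.log (r * (1 - s)) = Real.log r + Real.log (1 - s) :=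
    Real.log_mul hrpos.ne' s1.ne'
  have hly : Real.log (r * s) = Real.log r + Real.log s := Real.log_mul hrpos.ne' s0.ne'
  have hsum : r * s + r * (1 - s) = r := by ring
  have hfrac : r * s / r = s := by field_simp
  rw [hz, hyr, weightKernel, hsum, hfrac, hlz, hly, Real.mul_rpow s0.le s1.le,
    Real.mul_rpow hrpos.le s0.le, Real.mul_rpow hrpos.le s1.le, Real.rpow_neg hrpos.le,
    Real.rpow_neg s0.le, Real.rpow_neg s1.le, add_sub_cancel_right]
  have h3 : r ^ γ * r ^ (3 : ℕ) = r ^ ((γ + 3) / 2) * r ^ ((γ + 3) / 2) := by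
    rw [← Real.rpow_add hrpos, ← Real.rpow_natCast, ← Real.rpow_add hrpos]
    congr 1
    push_cast
    ring
  have a1 := (Real.rpow_pos_of_pos hrpos ((γ + 3) / 2)).ne'
  have a2 := (Real.rpow_pos_of_pos s0 ((γ + 3) / 2)).ne'
  have a3 := (Real.rpow_pos_of_pos s1 ((γ + 3) / 2)).ne'
  have a4 := hrpos.ne'
  have a5 := s0.ne'
  generalize r ^ ((γ + 3) / 2) = R at *
  generalize s ^ ((γ + 3) / 2) = S at *
  generalize (1 - s) ^ ((γ + 3) / 2) = T at *
  field_simp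
  linear_combination C ^ 2 * w s * g (Real.log r + Real.log s)
    * g (Real.log r + Real.log (1 - s)) * h3

theorem lintegral_log_antideriv {φ G : ℝ → ℝ} (hφ : Continuous φ) (hφ0 : ∀ t, 0 ≤ φ t)
    (hG : ∀ t, HasDerivAt G (φ t) t) {a b c l : ℝ} (ha : 0 < a) (hab : a ≤ b) (hc : 0 ≤ c) :
    ∫⁻ y in Ioo a b, ENNReal.ofReal (c * (1 / y * φ (Real.log y - l))) =
      ENNReal.ofReal (c * (G (Real.log b - l) - G (Real.log a - l))) := by
  have hpos : ∀ y ∈ uIcc a b, 0 < y := by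
    intro y hy
    rw [uIcc_of_le hab] at hy
    exact ha.trans_le hy.1
  have hcont : ContinuousOn (fun y => c * (1 / y * φ (Real.log y - l))) (uIcc a b) := by
    have hlog : ContinuousOn (fun y => Real.log y - l) (uIcc a b) :=
      (Real.continuousOn_log.mono fun y hy => (hpos y hy).ne').sub continuousOn_const
    refine continuousOn_const.mul ((continuousOn_const.div continuousOn_id fun y hy =>
      (hpos y hy).ne').mul (hφ.comp_continuousOn hlog))
  have hder : ∀ y ∈ uIcc a b, HasDerivAt (fun y => c * G (Real.log y - l))
      (c * (1 / y * φ (Real.log y - l))) y := by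
    intro y hy
    have h1 := (Real.hasDerivAt_log (hpos y hy).ne').sub_const l
    refine (((hG _).comp y h1).const_mul c).congr_deriv ?_
    rw [one_div, mul_comm (φ _)]
  have hint : IntervalIntegrable (fun y => c * (1 / y * φ (Real.log y - l))) volume a b :=
    hcont.intervalIntegrable
  have hFTC := intervalIntegral.integral_eq_sub_of_hasDerivAt hder hint
  rw [mul_sub, ← hFTC, intervalIntegral.integral_of_le hab, integral_Ioc_eq_integral_Ioo]
  refine (ofReal_integral_eq_lintegral_ofReal ?_ ?_).symm
  · exact ((intervalIntegrable_iff_integrableOn_Ioc_of_le hab).1 hint).mono_set Ioo_subset_Ioc_self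
  · refine (ae_restrict_iff' measurableSet_Ioo).2 (Eventually.of_forall fun y hy => ?_)
    have : 0 < y := ha.trans hy.1
    have := hφ0 (Real.log y - l)
    positivity

/-- Flux of a modulated power law, as an integral over the fraction `s`. -/
theorem flux_weightKernel_eq {γ C : ℝ} {w g : ℝ → ℝ} {G : ℝ → ℝ → ℝ} (hw : Measurable w)
    (hw0 : ∀ s ∈ Ioo (0 : ℝ) 1, 0 ≤ w s) (hg : Continuous g) (hg0 : ∀ t, 0 ≤ g t)
    (hG : ∀ s t, HasDerivAt (G s) (g (t + Real.log s) * g (t + Real.log (1 - s))) t)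
    {x : ℝ} (hx : 0 < x) :
    flux (weightKernel γ w) (fun y => C * y ^ (-((γ + 3) / 2)) * g (Real.log y)) x =
      ∫⁻ s in Ioo (0 : ℝ) 1, ENNReal.ofReal (C ^ 2 * (w s * s) *
        (G s (Real.log x - Real.log s) - G s (Real.log x))) := by
  have hf : Measurable fun y : ℝ => C * y ^ (-((γ + 3) / 2)) * g (Real.log y) := by
    have := hg.measurable
    fun_prop
  have hK : Measurable (Function.uncurry (weightKernel γ w)) := by
    unfold weightKernel Function.uncurry
    fun_prop
  have hH : Measurable (Function.uncurry fun y z => ENNReal.ofReal (weightKernel γ w y z * y *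
      (C * y ^ (-((γ + 3) / 2)) * g (Real.log y)) *
      (C * z ^ (-((γ + 3) / 2)) * g (Real.log z)))) := by
    refine ENNReal.measurable_ofReal.comp ?_
    exact ((hK.mul measurable_fst).mul (hf.comp measurable_fst)).mul (hf.comp measurable_snd)
  rw [flux, lintegral_flux_region_eq hH hx]
  refine setLIntegral_congr_fun measurableSet_Ioo fun s hs => ?_
  have hsx : 0 < s * x := mul_pos hs.1 hx
  have h1 := lintegral_log_antideriv (φ := fun t => g (t + Real.log s) * g (t + Real.log (1 - s)))
    (G := G s) (by fun_prop) (fun t => mul_nonneg (hg0 _) (hg0 _)) (hG s) (a := s * x) (b := x)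
    (c := C ^ 2 * (w s * s)) (l := Real.log s) hsx (by nlinarith [hs.2])
    (mul_nonneg (sq_nonneg C) (mul_nonneg (hw0 s hs) hs.1.le))
  have h2 : Real.log (s * x) - Real.log s = Real.log x := by
    rw [Real.log_mul hs.1.ne' hx.ne']; ring
  rw [h2] at h1
  rw [← h1]
  refine setLIntegral_congr_fun measurableSet_Ioo fun y hy => ?_
  have hy0 : 0 < y := hsx.trans hy.1
  rw [← ENNReal.ofReal_mul (by positivity), weightKernel_integrand_eq γ C w g hs hy0]

/-! ### Fourier expansion of the modulated flux -/

/-- The log-periodic modulation `1 + 2ε cos ωt + (3/5) ε² cos 2ωt`. -/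
noncomputable def profile (ε ω t : ℝ) : ℝ :=
  1 + 2 * ε * Real.cos (ω * t) + 3 / 5 * ε ^ 2 * Real.cos (2 * (ω * t))

theorem continuous_profile (ε ω : ℝ) : Continuous (profile ε ω) := by
  unfold profile; fun_prop

/-- The Fourier coefficients of the product of two shifted profiles, up to powers of `ε`. -/
noncomputable def modalCoeff (ε : ℝ) (A B : ℂ) (m : Fin 4) : ℂ :=
  pairCoeff A B m + (Pi.single 0 (ε ^ 2 * (3 / 10 * (A ^ 2 * conj B + conj A * B ^ 2))) :
    Fin 4 → ℂ) m

/-- The mean of the product of two shifted profiles. -/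
noncomputable def meanCoeff (ε : ℝ) (A B : ℂ) : ℝ :=
  1 + 2 * ε ^ 2 * (A * conj B).re + 9 / 50 * ε ^ 4 * ((A * conj B) ^ 2).re

theorem cos_eq_re_exp (θ : ℝ) : Real.cos θ = (Complex.exp (θ * Complex.I)).re :=
  (Complex.exp_ofReal_mul_I_re θ).symm

theorem modalCoeff_zero (ε : ℝ) (A B : ℂ) : modalCoeff ε A B 0 =
    A + B + ε ^ 2 * (3 / 10 * (A ^ 2 * conj B + conj A * B ^ 2)) := by
  simp [modalCoeff, pairCoeff]

theorem modalCoeff_one (ε : ℝ) (A B : ℂ) : modalCoeff ε A B 1 =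
    A * B + 3 / 10 * (A ^ 2 + B ^ 2) := by
  simp [modalCoeff, pairCoeff]

theorem modalCoeff_two (ε : ℝ) (A B : ℂ) : modalCoeff ε A B 2 =
    3 / 10 * (A ^ 2 * B + A * B ^ 2) := by
  simp [modalCoeff, pairCoeff]

theorem modalCoeff_three (ε : ℝ) (A B : ℂ) : modalCoeff ε A B 3 =
    9 / 100 * (A ^ 2 * B ^ 2) := by
  simp [modalCoeff, pairCoeff]

theorem trig_product_re (ε : ℝ) (P Q : ℂ) :
    (1 + 2 * ε * P.re + 3 / 5 * ε ^ 2 * (P ^ 2).re) *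
      (1 + 2 * ε * Q.re + 3 / 5 * ε ^ 2 * (Q ^ 2).re) =
    meanCoeff ε P Q + (∑ m : Fin 4, 2 * (ε : ℂ) ^ (m.1 + 1) * modalCoeff ε P Q m).re := by
  have hre : ∀ (k : ℕ) (z : ℂ), (2 * (ε : ℂ) ^ k * z).re = 2 * ε ^ k * z.re := by
    intro k z
    rw [← Complex.re_ofReal_mul]
    push_cast
    rfl
  have c1 : (3 / 10 : ℂ) = ((3 / 10 : ℝ) : ℂ) := by norm_num
  have c2 : (9 / 100 : ℂ) = ((9 / 100 : ℝ) : ℂ) := by norm_num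
  have hsum : (∑ m : Fin 4, 2 * (ε : ℂ) ^ (m.1 + 1) * modalCoeff ε P Q m).re =
      2 * ε ^ 1 * (modalCoeff ε P Q 0).re + 2 * ε ^ 2 * (modalCoeff ε P Q 1).re
        + 2 * ε ^ 3 * (modalCoeff ε P Q 2).re + 2 * ε ^ 4 * (modalCoeff ε P Q 3).re := by
    rw [Fin.sum_univ_four, Complex.add_re, Complex.add_re, Complex.add_re, hre, hre, hre, hre]
    rfl
  rw [hsum, modalCoeff_zero, modalCoeff_one, modalCoeff_two, modalCoeff_three, c1, c2,
    ← Complex.ofReal_pow, meanCoeff]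
  simp only [pow_two, Complex.add_re, Complex.mul_re, Complex.mul_im, Complex.add_im,
    Complex.ofReal_re, Complex.ofReal_im, Complex.conj_re, Complex.conj_im]
  ring

theorem profile_eq_re (ε ω t : ℝ) : profile ε ω t =
    1 + 2 * ε * (Complex.exp ((ω * t : ℝ) * Complex.I)).re
      + 3 / 5 * ε ^ 2 * (Complex.exp ((ω * t : ℝ) * Complex.I) ^ 2).re := by
  have h : Complex.exp ((ω * t : ℝ) * Complex.I) ^ 2
      = Complex.exp ((2 * (ω * t) : ℝ) * Complex.I) := by
    rw [← Complex.exp_nat_mul]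
    congr 1
    push_cast
    ring
  rw [h, profile, cos_eq_re_exp, cos_eq_re_exp]

theorem norm_phase (ω s : ℝ) : ‖phase ω s‖ = 1 := Complex.norm_exp_ofReal_mul_I _

/-- With z = e^(iωt) the shifted profiles are evaluated at zA and zB; mode m has degree m+1 under
this joint rotation and the mean has degree 0. -/
theorem profile_mul_profile (ε ω s t : ℝ) :
    profile ε ω (t + Real.log s) * profile ε ω (t + Real.log (1 - s)) =
      meanCoeff ε (phase ω s) (phase ω (1 - s)) +
      (∑ m : Fin 4, 2 * (ε : ℂ) ^ (m.1 + 1) * modalCoeff ε (phase ω s) (phase ω (1 - s)) m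
        * Complex.exp ((m.1 + 1 : ℕ) * ((ω * t : ℝ) * Complex.I))).re := by
  obtain ⟨z, hz⟩ : ∃ z, z = Complex.exp ((ω * t : ℝ) * Complex.I) := ⟨_, rfl⟩
  have hzz : z * conj z = 1 := by
    rw [hz, ← Complex.exp_conj, ← Complex.exp_add]; simp
  have hadd : ∀ r, Complex.exp ((ω * (t + Real.log r) : ℝ) * Complex.I) = z * phase ω r := by
    intro r
    rw [hz, phase, ← Complex.exp_add]
    congr 1
    push_cast
    ring
  rw [profile_eq_re, profile_eq_re, hadd, hadd, trig_product_re]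
  generalize phase ω s = A
  generalize phase ω (1 - s) = B
  have hmean : z * A * conj (z * B) = A * conj B := by
    rw [map_mul]
    linear_combination A * conj B * hzz
  congr 1
  · rw [meanCoeff, meanCoeff, hmean]
  · congr 1
    refine Finset.sum_congr rfl fun m _ => ?_
    rw [Complex.exp_nat_mul, ← hz, mul_assoc (2 * (ε : ℂ) ^ (m.1 + 1))]
    congr 1
    fin_cases m
    · change modalCoeff ε (z * A) (z * B) 0 = modalCoeff ε A B 0 * z ^ 1
      rw [modalCoeff_zero, modalCoeff_zero, map_mul, map_mul]
      linear_combination ((ε : ℂ) ^ 2 * (3 / 10) * z * (A ^ 2 * conj B + conj A * B ^ 2)) * hzz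
    · change modalCoeff ε (z * A) (z * B) 1 = modalCoeff ε A B 1 * z ^ 2
      rw [modalCoeff_one, modalCoeff_one]
      ring
    · change modalCoeff ε (z * A) (z * B) 2 = modalCoeff ε A B 2 * z ^ 3
      rw [modalCoeff_two, modalCoeff_two]
      ring
    · change modalCoeff ε (z * A) (z * B) 3 = modalCoeff ε A B 3 * z ^ 4
      rw [modalCoeff_three, modalCoeff_three]
      ring

/-- An antiderivative of the product of two profiles shifted by `log s` and `log (1-s)`. -/
noncomputable def potential (ε ω s t : ℝ) : ℝ :=
  meanCoeff ε (phase ω s) (phase ω (1 - s)) * t +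
    (∑ m : Fin 4, 2 * (ε : ℂ) ^ (m.1 + 1) * modalCoeff ε (phase ω s) (phase ω (1 - s)) m
      * (Complex.exp ((m.1 + 1 : ℕ) * ((ω * t : ℝ) * Complex.I))
        / ((m.1 + 1 : ℕ) * ω * Complex.I))).re

theorem hasDerivAt_potential (ε : ℝ) {ω : ℝ} (hω : ω ≠ 0) (s t : ℝ) :
    HasDerivAt (potential ε ω s)
      (profile ε ω (t + Real.log s) * profile ε ω (t + Real.log (1 - s))) t := by
  rw [profile_mul_profile]
  have hm : ∀ m : Fin 4, HasDerivAt (fun t : ℝ =>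
      Complex.exp ((m.1 + 1 : ℕ) * ((ω * t : ℝ) * Complex.I)) / ((m.1 + 1 : ℕ) * ω * Complex.I))
      (Complex.exp ((m.1 + 1 : ℕ) * ((ω * t : ℝ) * Complex.I))) t := by
    intro m
    have hne : ((m.1 + 1 : ℕ) : ℂ) * ω * Complex.I ≠ 0 := by
      have : ((m.1 + 1 : ℕ) : ℂ) ≠ 0 := Nat.cast_ne_zero.2 (Nat.succ_ne_zero _)
      simp only [ne_eq, mul_eq_zero, Complex.I_ne_zero, or_false, Complex.ofReal_eq_zero]
      tauto
    have h1 : HasDerivAt (fun t : ℝ => ((m.1 + 1 : ℕ) : ℂ) * ω * Complex.I * (t : ℂ))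
        (((m.1 + 1 : ℕ) : ℂ) * ω * Complex.I * 1) t :=
      (Complex.ofRealCLM.hasDerivAt).const_mul _
    have h2 := (h1.cexp).div_const (((m.1 + 1 : ℕ) : ℂ) * ω * Complex.I)
    have e : ∀ t : ℝ, ((m.1 + 1 : ℕ) : ℂ) * ω * Complex.I * (t : ℂ)
        = (m.1 + 1 : ℕ) * ((ω * t : ℝ) * Complex.I) := by
      intro t; push_cast; ring
    simp only [e] at h2
    refine h2.congr_deriv ?_
    rw [mul_one, mul_div_assoc, div_self hne, mul_one]
  have hsum := HasDerivAt.fun_sum (u := Finset.univ) fun (m : Fin 4) _ =>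
    (hm m).const_mul (2 * (ε : ℂ) ^ (m.1 + 1) * modalCoeff ε (phase ω s) (phase ω (1 - s)) m)
  have hre := (Complex.reCLM.hasFDerivAt).comp_hasDerivAt t hsum
  have hlin := (hasDerivAt_id t).const_mul (meanCoeff ε (phase ω s) (phase ω (1 - s)))
  refine ((hlin.add hre).congr_deriv ?_).congr_of_eventuallyEq
    (Eventually.of_forall fun t => ?_)
  · simp
  · simp [potential]

/-- Shifting t by -log s multiplies mode m by the conjugate phase to the power m+1. Only these
oscillating terms depend on u, so they are what must integrate to zero. -/
theorem potential_sub (ε ω s u : ℝ) :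
    potential ε ω s (u - Real.log s) - potential ε ω s u =
      meanCoeff ε (phase ω s) (phase ω (1 - s)) * (-Real.log s) +
      (∑ m : Fin 4, 2 * (ε : ℂ) ^ (m.1 + 1)
        * (Complex.exp ((m.1 + 1 : ℕ) * ((ω * u : ℝ) * Complex.I))
          / ((m.1 + 1 : ℕ) * ω * Complex.I))
        * (modalCoeff ε (phase ω s) (phase ω (1 - s)) m
          * (conj (phase ω s) ^ (m.1 + 1) - 1))).re := by
  have hexp : ∀ m : Fin 4,
      Complex.exp ((m.1 + 1 : ℕ) * ((ω * (u - Real.log s) : ℝ) * Complex.I)) =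
        Complex.exp ((m.1 + 1 : ℕ) * ((ω * u : ℝ) * Complex.I))
          * conj (phase ω s) ^ (m.1 + 1) := by
    intro m
    rw [phase, ← Complex.exp_conj, ← Complex.exp_nat_mul, ← Complex.exp_add]
    congr 1
    simp
    ring
  simp only [potential, hexp]
  have : ∀ a b c d e : ℝ, a * (u - e) + b - (a * u + c) = a * (-e) + (b - c) := by
    intros; ring
  rw [this _ _ _ 0 _, ← Complex.sub_re, ← Finset.sum_sub_distrib]
  congr 2
  refine Finset.sum_congr rfl fun m _ => ?_
  ring

/-! ### Integrability and symmetrization of the mode integrals -/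

theorem integrableOn_beta_rpow {r : ℝ} (hr : r < 1) :
    IntegrableOn (fun s : ℝ => (s * (1 - s)) ^ (-r)) (Ioo 0 1) := by
  have hu : 0 < ((1 - r : ℝ) : ℂ).re := by simpa using hr
  have h1 := (Complex.betaIntegral_convergent hu hu).norm
  rw [intervalIntegrable_iff_integrableOn_Ioo_of_le zero_le_one] at h1
  refine h1.congr_fun (fun s hs => ?_) measurableSet_Ioo
  have s1 : 0 < 1 - s := sub_pos.2 hs.2
  have e : (1 - (s : ℂ)) = ((1 - s : ℝ) : ℂ) := by push_cast; rfl
  simp only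
  rw [norm_mul, e, Complex.norm_cpow_eq_rpow_re_of_pos hs.1,
    Complex.norm_cpow_eq_rpow_re_of_pos s1, Real.mul_rpow hs.1.le s1.le]
  simp

/-- Symmetric weights on `(0,1)` with singularities at most `(s(1-s))^{-q}`. -/
structure IsFluxWeight (q : ℝ) (w : ℝ → ℝ) : Prop where
  measurable : Measurable w
  continuousOn : ContinuousOn w (Ioo 0 1)
  symm : ∀ s, w (1 - s) = w s
  bound : ∃ M : ℝ, ∀ s ∈ Ioo (0 : ℝ) 1, |w s| ≤ M * (s * (1 - s)) ^ (-q)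

/-- One bound for both endpoints: the logarithm costs an arbitrarily small power at s = 0, and its
zero at s = 1 supplies the power of 1-s. -/
theorem mul_abs_log_le {η s : ℝ} (hη : 0 < η) (hη1 : η ≤ 1) (hs : s ∈ Ioo (0 : ℝ) 1) :
    s * |Real.log s| ≤ η⁻¹ * (s * (1 - s)) ^ (1 - η) := by
  have s0 := hs.1
  have s1 : 0 < 1 - s := sub_pos.2 hs.2
  have hp := Real.rpow_pos_of_pos s0 η
  have h1 : -Real.log s ≤ η⁻¹ * ((s ^ η)⁻¹ - 1) := by
    have h2 := Real.log_le_sub_one_of_pos (inv_pos.2 hp)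
    rw [Real.log_inv, Real.log_rpow s0] at h2
    rw [inv_mul_eq_div, le_div_iff₀ hη]
    linarith
  have h3 : s ≤ s ^ η := by
    simpa using Real.rpow_le_rpow_of_exponent_ge s0 hs.2.le hη1
  have h4 : 1 - s ≤ (1 - s) ^ (1 - η) := by
    simpa using Real.rpow_le_rpow_of_exponent_ge s1 (by linarith) (by linarith : 1 - η ≤ 1)
  have h5 : s ^ (1 - η) = s * (s ^ η)⁻¹ := by
    rw [Real.rpow_sub s0, Real.rpow_one, div_eq_mul_inv]
  have h6 : (s ^ η)⁻¹ - 1 ≤ (s ^ η)⁻¹ * (1 - s) ^ (1 - η) := by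
    have : (s ^ η)⁻¹ - 1 = (s ^ η)⁻¹ * (1 - s ^ η) := by field_simp
    rw [this]
    exact mul_le_mul_of_nonneg_left (by linarith) (inv_pos.2 hp).le
  rw [abs_of_neg (Real.log_neg s0 hs.2), Real.mul_rpow s0.le s1.le, h5]
  have h7 := mul_le_mul_of_nonneg_left (h1.trans
    (mul_le_mul_of_nonneg_left h6 (inv_pos.2 hη).le)) s0.le
  linarith

theorem IsFluxWeight.integrableOn_mul {q : ℝ} {w : ℝ → ℝ} (hw : IsFluxWeight q w)
    (hq0 : 0 ≤ q) (hq : q < 2) {c : ℝ → ℂ} (hc : ContinuousOn c (Ioo 0 1)) {N : ℝ}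
    (hN : ∀ s ∈ Ioo (0 : ℝ) 1, ‖c s‖ ≤ N * |Real.log s|) :
    IntegrableOn (fun s => ((w s * s : ℝ) : ℂ) * c s) (Ioo 0 1) := by
  obtain ⟨M, hM⟩ := hw.bound
  have hN0 : 0 ≤ N := by
    have h1 := (norm_nonneg _).trans (hN (1 / 2) ⟨by norm_num, by norm_num⟩)
    have h2 : 0 < |Real.log (1 / 2)| :=
      abs_pos.2 (Real.log_neg (by norm_num) (by norm_num)).ne
    exact nonneg_of_mul_nonneg_left h1 h2
  -- With η = 1 - q/2 the total exponent is -q + (1 - η) = -q/2, which exceeds -1 exactly because q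
  -- < 2.
  have hη : 0 < 1 - q / 2 := by linarith
  have hmain := (integrableOn_beta_rpow (r := q / 2) (by linarith)).const_mul
    (M * N * (1 - q / 2)⁻¹)
  have hcont : ContinuousOn (fun s => ((w s * s : ℝ) : ℂ) * c s) (Ioo 0 1) :=
    (Complex.continuous_ofReal.comp_continuousOn (hw.continuousOn.mul continuousOn_id)).mul hc
  refine Integrable.mono' hmain (hcont.aestronglyMeasurable measurableSet_Ioo) ?_
  refine (ae_restrict_iff' measurableSet_Ioo).2 (Eventually.of_forall fun s hs => ?_)
  have hss : 0 < s * (1 - s) := mul_pos hs.1 (sub_pos.2 hs.2)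
  have h1 := hM s hs
  have h2 := mul_abs_log_le hη (by linarith) hs
  have h3 : (s * (1 - s)) ^ (-q) * (s * (1 - s)) ^ (1 - (1 - q / 2))
      = (s * (1 - s)) ^ (-(q / 2)) := by
    rw [← Real.rpow_add hss]; congr 1; ring
  rw [norm_mul, Complex.norm_real, Real.norm_eq_abs, abs_mul, abs_of_pos hs.1, ← h3]
  calc |w s| * s * ‖c s‖ ≤ |w s| * s * (N * |Real.log s|) := by
        have := hN s hs
        have := hs.1
        gcongr
    _ = N * (|w s| * (s * |Real.log s|)) := by ring
    _ ≤ N * ((M * (s * (1 - s)) ^ (-q)) *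
        ((1 - q / 2)⁻¹ * (s * (1 - s)) ^ (1 - (1 - q / 2)))) := by
        have : 0 ≤ s * |Real.log s| := mul_nonneg hs.1.le (abs_nonneg _)
        gcongr
        exact (abs_nonneg _).trans h1
    _ = _ := by ring

theorem norm_conj_phase_pow_sub_one_le {ω : ℝ} (hω : 0 < ω) (s : ℝ) (k : ℕ) :
    ‖conj (phase ω s) ^ k - 1‖ ≤ k * ω * |Real.log s| := by
  have h : conj (phase ω s) ^ k = Complex.exp (Complex.I * ((-(k * ω * Real.log s) : ℝ))) := by
    rw [phase, ← Complex.exp_conj, ← Complex.exp_nat_mul]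
    congr 1
    simp
    ring
  rw [h]
  refine Real.norm_exp_I_mul_ofReal_sub_one_le.trans (le_of_eq ?_)
  rw [norm_neg, Real.norm_eq_abs, abs_mul, abs_of_nonneg (by positivity)]

section Symmetrization

variable {q ω : ℝ} {w : ℝ → ℝ} {c : ℝ → ℂ} {N : ℝ}

theorem IsFluxWeight.integrableOn_mul_phase (hw : IsFluxWeight q w) (hq0 : 0 ≤ q) (hq : q < 2)
    (hω : 0 < ω) (hc : ContinuousOn c (Ioo 0 1)) (hN : ∀ s, ‖c s‖ ≤ N) (k : ℕ) :
    IntegrableOn (fun s => ((w s * s : ℝ) : ℂ) * (c s * (conj (phase ω s) ^ k - 1)))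
      (Ioo 0 1) := by
  refine hw.integrableOn_mul hq0 hq (N := N * (k * ω)) ?_ fun s _ => ?_
  · exact hc.mul (((Complex.continuous_conj.comp_continuousOn (continuousOn_phase_left ω)).pow
      k).sub continuousOn_const)
  · rw [norm_mul, mul_assoc]
    exact mul_le_mul (hN s) (norm_conj_phase_pow_sub_one_le hω s k) (norm_nonneg _)
      ((norm_nonneg _).trans (hN s))

/-- The weight and the coefficient are invariant under s ↔ 1-s, so adding the reflected integrand
only symmetrizes the factor s(conj(phase)^k - 1). The moments thus become those of a symmetric
curve, matching the symmetric bumps available. -/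
theorem symmetrized_eq (hw : IsFluxWeight q w) (hcs : ∀ s, c (1 - s) = c s) (k : ℕ) (s : ℝ) :
    (w s : ℂ) * (c s * (1 - s * conj (phase ω s) ^ k - (1 - s) * conj (phase ω (1 - s)) ^ k)) =
      -(((w s * s : ℝ) : ℂ) * (c s * (conj (phase ω s) ^ k - 1)) +
        ((w (1 - s) * (1 - s) : ℝ) : ℂ) * (c (1 - s) * (conj (phase ω (1 - s)) ^ k - 1))) := by
  rw [hw.symm, hcs]
  push_cast
  ring

theorem integrableOn_comp_one_sub {F : ℝ → ℂ} (hF : IntegrableOn F (Ioo 0 1)) :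
    IntegrableOn (fun s => F (1 - s)) (Ioo 0 1) := by
  rw [← intervalIntegrable_iff_integrableOn_Ioo_of_le zero_le_one] at hF ⊢
  have := (hF.comp_sub_left 1).symm
  simpa using this

theorem setIntegral_comp_one_sub (F : ℝ → ℂ) :
    ∫ s in Ioo (0 : ℝ) 1, F (1 - s) = ∫ s in Ioo (0 : ℝ) 1, F s := by
  rw [← integral_Ioc_eq_integral_Ioo, ← integral_Ioc_eq_integral_Ioo,
    ← intervalIntegral.integral_of_le zero_le_one, ← intervalIntegral.integral_of_le zero_le_one,
    intervalIntegral.integral_comp_sub_left]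
  simp

theorem IsFluxWeight.integrableOn_symmetrized (hw : IsFluxWeight q w) (hq0 : 0 ≤ q) (hq : q < 2)
    (hω : 0 < ω) (hc : ContinuousOn c (Ioo 0 1)) (hcs : ∀ s, c (1 - s) = c s)
    (hN : ∀ s, ‖c s‖ ≤ N) (k : ℕ) :
    IntegrableOn (fun s => (w s : ℂ) * (c s * (1 - s * conj (phase ω s) ^ k
      - (1 - s) * conj (phase ω (1 - s)) ^ k))) (Ioo 0 1) := by
  have h1 := hw.integrableOn_mul_phase hq0 hq hω hc hN k
  have h2 := integrableOn_comp_one_sub h1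
  simp_rw [symmetrized_eq hw hcs]
  exact (h1.add h2).neg

theorem IsFluxWeight.integral_symmetrized (hw : IsFluxWeight q w) (hq0 : 0 ≤ q) (hq : q < 2)
    (hω : 0 < ω) (hc : ContinuousOn c (Ioo 0 1)) (hcs : ∀ s, c (1 - s) = c s)
    (hN : ∀ s, ‖c s‖ ≤ N) (k : ℕ) :
    ∫ s in Ioo (0 : ℝ) 1, (w s : ℂ) * (c s * (1 - s * conj (phase ω s) ^ k
      - (1 - s) * conj (phase ω (1 - s)) ^ k)) =
    -2 * ∫ s in Ioo (0 : ℝ) 1, ((w s * s : ℝ) : ℂ) * (c s * (conj (phase ω s) ^ k - 1)) := by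
  have h1 := hw.integrableOn_mul_phase hq0 hq hω hc hN k
  have h2 := integrableOn_comp_one_sub h1
  simp_rw [symmetrized_eq hw hcs]
  rw [integral_neg, integral_add h1 h2, setIntegral_comp_one_sub
    (fun s => ((w s * s : ℝ) : ℂ) * (c s * (conj (phase ω s) ^ k - 1)))]
  ring

end Symmetrization

/-! ### Vanishing moments imply constant flux -/

theorem continuous_modalCoeff (ε : ℝ) (m : Fin 4) :
    Continuous fun z : ℂ × ℂ => modalCoeff ε z.1 z.2 m := by
  have h1 : Continuous fun z : ℂ × ℂ => conj z.1 := Complex.continuous_conj.comp continuous_fst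
  have h2 : Continuous fun z : ℂ × ℂ => conj z.2 := Complex.continuous_conj.comp continuous_snd
  fin_cases m
  · change Continuous fun z : ℂ × ℂ => modalCoeff ε z.1 z.2 0
    simp_rw [modalCoeff_zero]; fun_prop
  · change Continuous fun z : ℂ × ℂ => modalCoeff ε z.1 z.2 1
    simp_rw [modalCoeff_one]; fun_prop
  · change Continuous fun z : ℂ × ℂ => modalCoeff ε z.1 z.2 2
    simp_rw [modalCoeff_two]; fun_prop
  · change Continuous fun z : ℂ × ℂ => modalCoeff ε z.1 z.2 3
    simp_rw [modalCoeff_three]; fun_prop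

theorem modalCoeff_comm (ε : ℝ) (A B : ℂ) (m : Fin 4) :
    modalCoeff ε A B m = modalCoeff ε B A m := by
  unfold modalCoeff
  rw [pairCoeff_comm]
  congr 3
  ring

theorem continuousOn_phase_prod (ω : ℝ) :
    ContinuousOn (fun s => (phase ω s, phase ω (1 - s))) (Ioo 0 1) :=
  (continuousOn_phase_left ω).prodMk (continuousOn_phase_right ω)

theorem exists_bound_of_continuous {F : ℂ × ℂ → ℂ} (hF : Continuous F) :
    ∃ N, ∀ ω s : ℝ, ‖F (phase ω s, phase ω (1 - s))‖ ≤ N := by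
  have hK : IsCompact (Metric.closedBall (0 : ℂ × ℂ) 1) := isCompact_closedBall 0 1
  obtain ⟨N, hN⟩ := hK.exists_bound_of_continuousOn hF.continuousOn
  refine ⟨N, fun ω s => hN _ ?_⟩
  rw [mem_closedBall_zero_iff, Prod.norm_def, norm_phase, norm_phase, max_self]

/-- The `m`-th mode integrand of the flux of the modulated power law. -/
noncomputable def modalCurve (ε ω s : ℝ) (m : Fin 4) : ℂ :=
  modalCoeff ε (phase ω s) (phase ω (1 - s)) m *
    (1 - s * conj (phase ω s) ^ (m.1 + 1) - (1 - s) * conj (phase ω (1 - s)) ^ (m.1 + 1))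

/-- The intensity of the flux: its mean over one period. -/
noncomputable def fluxMean (ε ω : ℝ) (w : ℝ → ℝ) : ℝ :=
  ∫ s in Ioo (0 : ℝ) 1, w s * s * (meanCoeff ε (phase ω s) (phase ω (1 - s)) * (-Real.log s))

theorem continuous_meanCoeff (ε : ℝ) : Continuous fun z : ℂ × ℂ => meanCoeff ε z.1 z.2 := by
  have h2 : Continuous fun z : ℂ × ℂ => conj z.2 := Complex.continuous_conj.comp continuous_snd
  unfold meanCoeff
  fun_prop

theorem IsFluxWeight.integrableOn_mean {q : ℝ} {w : ℝ → ℝ} (hw : IsFluxWeight q w)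
    (hq0 : 0 ≤ q) (hq : q < 2) (ε ω : ℝ) :
    IntegrableOn (fun s => w s * s *
      (meanCoeff ε (phase ω s) (phase ω (1 - s)) * (-Real.log s))) (Ioo 0 1) := by
  have hm : Continuous fun z : ℂ × ℂ => (meanCoeff ε z.1 z.2 : ℂ) :=
    Complex.continuous_ofReal.comp (continuous_meanCoeff ε)
  obtain ⟨N, hN⟩ := exists_bound_of_continuous hm
  have hlog : ContinuousOn (fun s => ((-Real.log s : ℝ) : ℂ)) (Ioo 0 1) :=
    Complex.continuous_ofReal.comp_continuousOn
      (Real.continuousOn_log.mono fun s hs => hs.1.ne').neg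
  have hc : ContinuousOn (fun s => (meanCoeff ε (phase ω s) (phase ω (1 - s)) : ℂ)
      * ((-Real.log s : ℝ) : ℂ)) (Ioo 0 1) :=
    (hm.comp_continuousOn (continuousOn_phase_prod ω)).mul hlog
  have h := (hw.integrableOn_mul hq0 hq (N := N) hc fun s _ => ?_).re
  · refine h.congr (Eventually.of_forall fun s => ?_)
    simp only [← Complex.ofReal_mul]
    exact Complex.ofReal_re _
  · rw [norm_mul, Complex.norm_real (-Real.log s), norm_neg, Real.norm_eq_abs]
    exact mul_le_mul_of_nonneg_right (hN ω s) (abs_nonneg _)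

/-- If the relevant moments of the weight vanish, the modulated power law has constant flux. -/
theorem flux_modulated_eq {γ q ε ω C : ℝ} {w : ℝ → ℝ} (hw : IsFluxWeight q w) (hq0 : 0 ≤ q)
    (hq : q < 2) (hω : 0 < ω) (hw0 : ∀ s ∈ Ioo (0 : ℝ) 1, 0 ≤ w s)
    (hprof : ∀ t, 0 ≤ profile ε ω t)
    (hmom : ∀ m : Fin 4, (ε : ℂ) ^ (m.1 + 1) *
      ∫ s in Ioo (0 : ℝ) 1, (w s : ℂ) * modalCurve ε ω s m = 0) {x : ℝ} (hx : 0 < x) :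
    flux (weightKernel γ w)
        (fun y => C * y ^ (-((γ + 3) / 2)) * profile ε ω (Real.log y)) x =
      ENNReal.ofReal (C ^ 2 * fluxMean ε ω w) := by
  rw [flux_weightKernel_eq hw.measurable hw0 (continuous_profile ε ω) hprof
    (hasDerivAt_potential ε hω.ne') hx]
  let u := Real.log x
  let κ : Fin 4 → ℂ := fun m => (Complex.exp ((m.1 + 1 : ℕ) * ((ω * u : ℝ) * Complex.I))
          / ((m.1 + 1 : ℕ) * ω * Complex.I))
  let D : Fin 4 → ℝ → ℂ := fun m s => ((w s * s : ℝ) : ℂ) *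
    (modalCoeff ε (phase ω s) (phase ω (1 - s)) m * (conj (phase ω s) ^ (m.1 + 1) - 1))
  have hcc : ∀ m, ContinuousOn (fun s => modalCoeff ε (phase ω s) (phase ω (1 - s)) m)
      (Ioo 0 1) := fun m =>
    ((continuous_modalCoeff ε m).comp_continuousOn (continuousOn_phase_prod ω)).congr
      fun s _ => rfl
  have hsy : ∀ m s, modalCoeff ε (phase ω (1 - s)) (phase ω (1 - (1 - s))) m =
      modalCoeff ε (phase ω s) (phase ω (1 - s)) m := fun m s => by
    rw [sub_sub_cancel, modalCoeff_comm]
  have hD : ∀ m, IntegrableOn (D m) (Ioo 0 1) := by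
    intro m
    obtain ⟨N, hN⟩ := exists_bound_of_continuous (continuous_modalCoeff ε m)
    exact hw.integrableOn_mul_phase hq0 hq hω (hcc m) (hN ω) _
  -- The factor ε^(m+1) is kept in the moment condition so that ε = 0, the pure power law, satisfies
  -- it for every weight.
  have hDz : ∀ m : Fin 4, 2 * (ε : ℂ) ^ (m.1 + 1) * κ m * ∫ s in Ioo (0 : ℝ) 1, D m s = 0 := by
    intro m
    obtain ⟨N, hN⟩ := exists_bound_of_continuous (continuous_modalCoeff ε m)
    have h1 := hw.integral_symmetrized hq0 hq hω (hcc m) (hsy m) (hN ω) (m.1 + 1)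
    have h2 := hmom m
    simp only [modalCurve] at h2
    rw [h1] at h2
    linear_combination (-κ m) * h2
  have hsumint : IntegrableOn (fun s => ∑ m : Fin 4, 2 * (ε : ℂ) ^ (m.1 + 1) * κ m * D m s) (Ioo 0 1) :=
    integrable_finsetSum _ fun m _ => (hD m).const_mul _
  have hsumre : IntegrableOn (fun s => (∑ m : Fin 4, 2 * (ε : ℂ) ^ (m.1 + 1) * κ m * D m s).re)
      (Ioo 0 1) := hsumint.re
  have hmean := hw.integrableOn_mean hq0 hq ε ω
  have hform : ∀ s, C ^ 2 * (w s * s) *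
      (potential ε ω s (Real.log x - Real.log s) - potential ε ω s (Real.log x)) =
      C ^ 2 * (w s * s * (meanCoeff ε (phase ω s) (phase ω (1 - s)) * (-Real.log s)) +
        (∑ m : Fin 4, 2 * (ε : ℂ) ^ (m.1 + 1) * κ m * D m s).re) := by
    intro s
    rw [potential_sub, mul_assoc, mul_add, ← Complex.re_ofReal_mul, Finset.mul_sum]
    congr 3
    refine Finset.sum_congr rfl fun m _ => ?_
    simp only [κ, D]
    ring
  have hint : IntegrableOn (fun s => C ^ 2 * (w s * s) *
      (potential ε ω s (Real.log x - Real.log s) - potential ε ω s (Real.log x))) (Ioo 0 1) := by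
    simp_rw [hform]
    exact (hmean.add hsumre).const_mul _
  rw [← ofReal_integral_eq_lintegral_ofReal hint]
  · congr 1
    simp_rw [hform]
    rw [integral_const_mul, integral_add hmean hsumre]
    have h3 : ∫ s in Ioo (0 : ℝ) 1, (∑ m : Fin 4, 2 * (ε : ℂ) ^ (m.1 + 1) * κ m * D m s).re = 0 := by
      refine (integral_re hsumint).trans ?_
      rw [integral_finsetSum _ fun m _ => (hD m).const_mul _]
      simp_rw [integral_const_mul, hDz]
      simp
    have h4 : ∀ a b c : ℝ, b = 0 → a = c → C ^ 2 * (a + b) = C ^ 2 * c := by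
      rintro a b c rfl rfl; rw [add_zero]
    exact h4 _ _ _ h3 rfl
  · refine (ae_restrict_iff' measurableSet_Ioo).2 (Eventually.of_forall fun s hs => ?_)
    -- The integrand is nonnegative because the potential has derivative a product of nonnegative
    -- profiles and -log s > 0.
    have hmono : Monotone (potential ε ω s) :=
      monotone_of_deriv_nonneg (fun t => (hasDerivAt_potential ε hω.ne' s t).differentiableAt)
        fun t => by
          rw [(hasDerivAt_potential ε hω.ne' s t).deriv]
          exact mul_nonneg (hprof _) (hprof _)
    have h1 : Real.log x ≤ Real.log x - Real.log s := by
      have := Real.log_neg hs.1 hs.2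
      linarith
    exact mul_nonneg (mul_nonneg (sq_nonneg C) (mul_nonneg (hw0 s hs) hs.1.le))
      (sub_nonneg.2 (hmono h1))

/-! ### Admissible weights and the ε-dependence of the moments -/

theorem angularPart_weightKernel (γ : ℝ) (w : ℝ → ℝ) (s : ℝ) :
    angularPart (weightKernel γ w) s = w s * (s * (1 - s)) ^ ((γ + 3) / 2) := by
  simp [angularPart, weightKernel]

theorem fraction_mem_Ioo {x y : ℝ} (hx : 0 < x) (hy : 0 < y) : x / (x + y) ∈ Ioo (0 : ℝ) 1 :=
  ⟨by positivity, (div_lt_one (by positivity)).2 (by linarith)⟩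

/-- Near 0 the weight is the unperturbed base, so s^p Φ(s) = (1-s)^(-p) there, with limit 1. -/
theorem isAdmissibleKernel_weightKernel {γ p : ℝ} {w : ℝ → ℝ} (hc : ContinuousOn w (Ioo 0 1))
    (hsymm : ∀ s, w (1 - s) = w s) (hpos : ∀ s ∈ Ioo (0 : ℝ) 1, 0 < w s)
    (hzero : ∀ᶠ s in 𝓝[>] (0 : ℝ), w s = (s * (1 - s)) ^ (-(p + (γ + 3) / 2))) :
    IsAdmissibleKernel γ p (weightKernel γ w) := by
  have hang : angularPart (weightKernel γ w) = fun s => w s * (s * (1 - s)) ^ ((γ + 3) / 2) :=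
    funext (angularPart_weightKernel γ w)
  have hss : ∀ s ∈ Ioo (0 : ℝ) 1, 0 < s * (1 - s) := fun s hs => mul_pos hs.1 (sub_pos.2 hs.2)
  have hcont : ContinuousOn (fun s : ℝ => w s * (s * (1 - s)) ^ ((γ + 3) / 2)) (Ioo 0 1) := by
    refine hc.mul (ContinuousOn.rpow_const (by fun_prop) fun s hs => Or.inl (hss s hs).ne')
  refine ⟨?_, fun x _ y _ => ?_, fun s _ => ?_, hang ▸ hcont, fun s hs => ?_, 1, one_pos, ?_⟩
  · have h1 : ContinuousOn (fun q : ℝ × ℝ => q.1 / (q.1 + q.2)) (Ioi 0 ×ˢ Ioi 0) :=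
      ContinuousOn.div (by fun_prop) (by fun_prop) fun q hq => (add_pos hq.1 hq.2).ne'
    have h2 : ContinuousOn (fun q : ℝ × ℝ => (q.1 + q.2) ^ γ) (Ioi 0 ×ˢ Ioi 0) :=
      ContinuousOn.rpow_const (by fun_prop) fun q hq => Or.inl (add_pos hq.1 hq.2).ne'
    have h3 : MapsTo (fun q : ℝ × ℝ => q.1 / (q.1 + q.2)) (Ioi 0 ×ˢ Ioi 0) (Ioo 0 1) :=
      fun q hq => fraction_mem_Ioo hq.1 hq.2
    exact h2.mul (hcont.comp h1 h3)
  · rw [angularPart_weightKernel, weightKernel]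
  · rw [angularPart_weightKernel, angularPart_weightKernel, hsymm, sub_sub_cancel, mul_comm s]
  · rw [angularPart_weightKernel]
    exact mul_pos (hpos s hs) (Real.rpow_pos_of_pos (hss s hs) _)
  · have hlim : Tendsto (fun s : ℝ => (1 - s) ^ (-p)) (𝓝[>] 0) (𝓝 1) := by
      have : ContinuousAt (fun s : ℝ => (1 - s) ^ (-p)) 0 :=
        ContinuousAt.rpow_const (by fun_prop) (Or.inl (by norm_num))
      have h2 := this.tendsto.mono_left (nhdsWithin_le_nhds (s := Ioi 0))
      simpa using h2
    refine hlim.congr' ?_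
    filter_upwards [hzero, Ioo_mem_nhdsGT (zero_lt_one' ℝ)] with s hs h01
    have s1 : 0 < 1 - s := sub_pos.2 h01.2
    rw [angularPart_weightKernel, hs, ← Real.rpow_add (hss s h01),
      show -(p + (γ + 3) / 2) + (γ + 3) / 2 = -p by ring, Real.mul_rpow h01.1.le s1.le,
      ← mul_assoc, ← Real.rpow_add h01.1, add_neg_cancel, Real.rpow_zero, one_mul]

theorem IsSymmBump.exists_bound_mul {h : ℝ → ℝ} (hh : IsSymmBump h) {g : ℝ → ℝ}
    (hg : ContinuousOn g (Ioo 0 1)) :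
    ∃ M : ℝ, 0 ≤ M ∧ ∀ s, |g s * h s| ≤ M := by
  obtain ⟨a, ha, hha⟩ := hh.support
  have hsub : Icc a (1 - a) ⊆ Ioo 0 1 := fun s hs => ⟨by linarith [hs.1], by linarith [hs.2]⟩
  obtain ⟨M, hM⟩ := (isCompact_Icc (a := a) (b := 1 - a)).exists_bound_of_continuousOn
    ((hg.mono hsub).mul hh.continuous.continuousOn)
  refine ⟨max M 0, le_max_right _ _, fun s => ?_⟩
  by_cases hs : s ∈ Icc a (1 - a)
  · exact (hM s hs).trans (le_max_left _ _)
  · rw [hha s hs, mul_zero, abs_zero]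
    exact le_max_right _ _

theorem IsSymmBump.exists_bound {h : ℝ → ℝ} (hh : IsSymmBump h) :
    ∃ M : ℝ, 0 ≤ M ∧ ∀ s, |h s| ≤ M := by
  simpa using hh.exists_bound_mul (g := fun _ => 1) continuousOn_const

theorem one_le_base_weight {q s : ℝ} (hq : 0 ≤ q) (hs : s ∈ Ioo (0 : ℝ) 1) :
    1 ≤ (s * (1 - s)) ^ (-q) :=
  Real.one_le_rpow_of_pos_of_le_one_of_nonpos (mul_pos hs.1 (sub_pos.2 hs.2))
    (by nlinarith [hs.1, hs.2]) (by linarith)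

theorem isFluxWeight_base_add {q : ℝ} (hq : 0 ≤ q) {h : ℝ → ℝ} (hh : IsSymmBump h) :
    IsFluxWeight q (fun s => (s * (1 - s)) ^ (-q) + h s) := by
  obtain ⟨M, hM0, hM⟩ := hh.exists_bound
  have hm := hh.continuous.measurable
  refine ⟨by fun_prop, ?_, fun s => ?_, 1 + M, fun s hs => ?_⟩
  · refine (ContinuousOn.rpow_const (by fun_prop) fun s hs => Or.inl ?_).add
      hh.continuous.continuousOn
    exact (mul_pos hs.1 (sub_pos.2 hs.2)).ne'
  · rw [hh.symm, sub_sub_cancel, mul_comm s]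
  · have h1 := one_le_base_weight hq hs
    have h2 := hM s
    refine (abs_add_le _ _).trans ?_
    rw [abs_of_nonneg (by linarith), add_mul, one_mul]
    nlinarith

theorem IsSymmBump.eventually_eq_zero {h : ℝ → ℝ} (hh : IsSymmBump h) :
    ∀ᶠ s in 𝓝[>] (0 : ℝ), h s = 0 := by
  obtain ⟨a, ha, hha⟩ := hh.support
  filter_upwards [Ioo_mem_nhdsGT ha] with s hs
  exact hha s fun h => not_lt.2 h.1 hs.2

/-- The correction of order `ε²` to the first mode integrand. -/
noncomputable def corrCurve (ω s : ℝ) : ℂ :=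
  3 / 10 * (phase ω s ^ 2 * conj (phase ω (1 - s)) + conj (phase ω s) * phase ω (1 - s) ^ 2) *
    (1 - s * conj (phase ω s) - (1 - s) * conj (phase ω (1 - s)))

/-- Up to conjugation, the product of harmonics of orders -1 and 2 is the only contribution to a
nonconstant mode beyond its leading power of ε; it lands in the first mode. -/
theorem modalCurve_eq (ε ω s : ℝ) (m : Fin 4) : modalCurve ε ω s m =
    modeCurve ω s m + ε ^ 2 * (Pi.single 0 (corrCurve ω s) : Fin 4 → ℂ) m := by
  simp only [modalCurve, modeCurve, modeVec, modalCoeff]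
  by_cases hm : m = 0
  · subst hm
    simp [corrCurve]
    ring
  · simp [Pi.single_eq_of_ne hm]

theorem continuousOn_corrCurve (ω : ℝ) : ContinuousOn (corrCurve ω) (Ioo 0 1) := by
  have h1 := continuousOn_phase_left ω
  have h2 := continuousOn_phase_right ω
  have h3 := Complex.continuous_conj.comp_continuousOn h1
  have h4 := Complex.continuous_conj.comp_continuousOn h2
  have h5 : ContinuousOn (fun s : ℝ => (s : ℂ)) (Ioo 0 1) := Complex.continuous_ofReal.continuousOn
  exact (continuousOn_const.mul (((h1.pow 2).mul h4).add (h3.mul (h2.pow 2)))).mul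
    ((continuousOn_const.sub (h5.mul h3)).sub ((continuousOn_const.sub h5).mul h4))

/-- The moment of a weight against the correction of the first mode. -/
noncomputable def corrIntegral (ω : ℝ) (w : ℝ → ℝ) : ℂ :=
  ∫ s in Ioo (0 : ℝ) 1, (w s : ℂ) * corrCurve ω s

theorem IsFluxWeight.integrableOn_modeCurve {q ω : ℝ} {w : ℝ → ℝ} (hw : IsFluxWeight q w)
    (hq0 : 0 ≤ q) (hq : q < 2) (hω : 0 < ω) (m : Fin 4) :
    IntegrableOn (fun s => (w s : ℂ) * modeCurve ω s m) (Ioo 0 1) := by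
  have h0 : ∀ A B, modalCoeff 0 A B m = pairCoeff A B m := by
    intro A B; simp [modalCoeff]
  have hF := continuous_modalCoeff 0 m
  simp_rw [h0] at hF
  obtain ⟨N, hN⟩ := exists_bound_of_continuous hF
  exact hw.integrableOn_symmetrized hq0 hq hω
    (c := fun s => pairCoeff (phase ω s) (phase ω (1 - s)) m)
    ((hF.comp_continuousOn (continuousOn_phase_prod ω)).congr fun s _ => rfl)
    (fun s => by rw [sub_sub_cancel, pairCoeff_comm]) (hN ω) (m.1 + 1)

theorem IsFluxWeight.integrableOn_corrCurve {q ω : ℝ} {w : ℝ → ℝ} (hw : IsFluxWeight q w)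
    (hq0 : 0 ≤ q) (hq : q < 2) (hω : 0 < ω) :
    IntegrableOn (fun s => (w s : ℂ) * corrCurve ω s) (Ioo 0 1) := by
  have hF : Continuous fun z : ℂ × ℂ =>
      3 / 10 * (z.1 ^ 2 * conj z.2 + conj z.1 * z.2 ^ 2) := by
    have h1 : Continuous fun z : ℂ × ℂ => conj z.1 := Complex.continuous_conj.comp continuous_fst
    have h2 : Continuous fun z : ℂ × ℂ => conj z.2 := Complex.continuous_conj.comp continuous_snd
    fun_prop
  obtain ⟨N, hN⟩ := exists_bound_of_continuous hF
  have h := hw.integrableOn_symmetrized hq0 hq hω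
    (c := fun s => 3 / 10 * (phase ω s ^ 2 * conj (phase ω (1 - s))
      + conj (phase ω s) * phase ω (1 - s) ^ 2))
    ((hF.comp_continuousOn (continuousOn_phase_prod ω)).congr fun s _ => rfl)
    (fun s => by rw [sub_sub_cancel]; ring) (hN ω) 1
  simpa only [pow_one, corrCurve] using h

theorem integral_modalCurve {ε ω : ℝ} {w : ℝ → ℝ}
    (h1 : ∀ m, IntegrableOn (fun s => (w s : ℂ) * modeCurve ω s m) (Ioo 0 1))
    (h2 : IntegrableOn (fun s => (w s : ℂ) * corrCurve ω s) (Ioo 0 1)) (m : Fin 4) :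
    ∫ s in Ioo (0 : ℝ) 1, (w s : ℂ) * modalCurve ε ω s m =
      modeIntegral ω w m + ε ^ 2 * (Pi.single 0 (corrIntegral ω w) : Fin 4 → ℂ) m := by
  simp_rw [modalCurve_eq]
  by_cases hm : m = 0
  · subst hm
    simp only [Pi.single_eq_same]
    rw [modeIntegral, corrIntegral, ← integral_const_mul, ← integral_add (h1 0) (h2.const_mul _)]
    congr 1
    funext s
    ring
  · simp [Pi.single_eq_of_ne hm, modeIntegral]

theorem corrIntegral_add_mul {ω : ℝ} {h k : ℝ → ℝ}
    (hh : IntegrableOn (fun s => (h s : ℂ) * corrCurve ω s) (Ioo 0 1))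
    (hk : IntegrableOn (fun s => (k s : ℂ) * corrCurve ω s) (Ioo 0 1)) (a b : ℝ) :
    corrIntegral ω (fun s => a * h s + b * k s) = a * corrIntegral ω h + b * corrIntegral ω k := by
  simp only [corrIntegral]
  rw [← integral_const_mul, ← integral_const_mul, ← integral_add (hh.const_mul _) (hk.const_mul _)]
  congr 1
  funext s
  push_cast
  ring

/-- Solvability of a small perturbation of the identity on `ℂ`, with continuous dependence. -/
theorem exists_continuous_solution (R L₁ L₂ : ℂ) {η : ℝ} (hη : 0 < η) :
    ∃ δ : ℝ, 0 < δ ∧ ∃ X Y : ℝ → ℝ, ContinuousOn X (Ioo (-δ) δ) ∧ ContinuousOn Y (Ioo (-δ) δ) ∧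
      ∀ ε ∈ Ioo (-δ) δ, |X ε| ≤ η ∧ |Y ε| ≤ η ∧
        (X ε + Y ε * Complex.I) + (ε : ℂ) ^ 2 * (R + X ε * L₁ + Y ε * L₂) = 0 := by
  -- Cramer's rule for the real and imaginary parts; the determinant is 1 at ε = 0 and both
  -- numerators vanish there.
  let D : ℝ → ℝ := fun ε =>
    (1 + ε ^ 2 * L₁.re) * (1 + ε ^ 2 * L₂.im) - ε ^ 2 * L₂.re * (ε ^ 2 * L₁.im)
  let X : ℝ → ℝ := fun ε =>
    (-(ε ^ 2 * R.re) * (1 + ε ^ 2 * L₂.im) + ε ^ 2 * L₂.re * (ε ^ 2 * R.im)) / D ε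
  let Y : ℝ → ℝ := fun ε =>
    (-(ε ^ 2 * R.im) * (1 + ε ^ 2 * L₁.re) + ε ^ 2 * L₁.im * (ε ^ 2 * R.re)) / D ε
  have hD : Continuous D := by fun_prop
  have hX : ∀ ε, D ε ≠ 0 → ContinuousAt X ε := fun ε h =>
    ContinuousAt.div (by fun_prop) hD.continuousAt h
  have hY : ∀ ε, D ε ≠ 0 → ContinuousAt Y ε := fun ε h =>
    ContinuousAt.div (by fun_prop) hD.continuousAt h
  have hD0 : D 0 ≠ 0 := by simp [D]
  have hX0 : X 0 = 0 := by simp [X]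
  have hY0 : Y 0 = 0 := by simp [Y]
  have hev : ∀ᶠ ε in 𝓝 (0 : ℝ), D ε ≠ 0 ∧ |X ε| < η ∧ |Y ε| < η := by
    refine (hD.continuousAt.eventually_ne hD0).and (((hX 0 hD0).abs.eventually_lt_const ?_).and
      ((hY 0 hD0).abs.eventually_lt_const ?_))
    · simpa [hX0] using hη
    · simpa [hY0] using hη
  obtain ⟨δ, hδ, hball⟩ := Metric.eventually_nhds_iff.1 hev
  have hmem : ∀ ε ∈ Ioo (-δ) δ, D ε ≠ 0 ∧ |X ε| < η ∧ |Y ε| < η := fun ε hε =>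
    hball (by rw [Real.dist_eq, sub_zero]; exact abs_lt.2 hε)
  refine ⟨δ, hδ, X, Y, fun ε hε => (hX ε (hmem ε hε).1).continuousWithinAt,
    fun ε hε => (hY ε (hmem ε hε).1).continuousWithinAt, fun ε hε => ?_⟩
  obtain ⟨h1, h2, h3⟩ := hmem ε hε
  refine ⟨h2.le, h3.le, ?_⟩
  have hXD : X ε * D ε = -(ε ^ 2 * R.re) * (1 + ε ^ 2 * L₂.im) + ε ^ 2 * L₂.re * (ε ^ 2 * R.im) :=
    div_mul_cancel₀ _ h1
  have hYD : Y ε * D ε = -(ε ^ 2 * R.im) * (1 + ε ^ 2 * L₁.re) + ε ^ 2 * L₁.im * (ε ^ 2 * R.re) :=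
    div_mul_cancel₀ _ h1
  have hDe : D ε = (1 + ε ^ 2 * L₁.re) * (1 + ε ^ 2 * L₂.im) - ε ^ 2 * L₂.re * (ε ^ 2 * L₁.im) :=
    rfl
  rw [← Complex.ofReal_pow]
  generalize X ε = x at *
  generalize Y ε = y at *
  generalize D ε = d at *
  apply Complex.ext
  · simp [-Complex.ofReal_pow]
    refine mul_right_cancel₀ h1 ?_
    rw [zero_mul]
    linear_combination (1 + ε ^ 2 * L₁.re) * hXD + ε ^ 2 * L₂.re * hYD + ε ^ 2 * R.re * hDe
  · simp [-Complex.ofReal_pow]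
    refine mul_right_cancel₀ h1 ?_
    rw [zero_mul]
    linear_combination (1 + ε ^ 2 * L₂.im) * hYD + ε ^ 2 * L₁.im * hXD + ε ^ 2 * R.im * hDe

/-! ### The power law and the modulated solution -/

theorem profile_pos {ε : ℝ} (hε : |ε| ≤ 1 / 10) (ω t : ℝ) : 0 < profile ε ω t := by
  have h1 := abs_le.1 hε
  have hc1 := Real.abs_cos_le_one (ω * t)
  have hc2 := Real.neg_one_le_cos (2 * (ω * t))
  have h2 : |ε * Real.cos (ω * t)| ≤ 1 / 10 := by
    rw [abs_mul]
    nlinarith [abs_nonneg ε, abs_nonneg (Real.cos (ω * t))]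
  have h3 := (abs_le.1 h2).1
  have h4 : ε ^ 2 ≤ 1 / 100 := by nlinarith
  unfold profile
  nlinarith [mul_nonneg (sq_nonneg ε) (by linarith : 0 ≤ 1 + Real.cos (2 * (ω * t)))]

theorem meanCoeff_pos {ε : ℝ} (hε : |ε| ≤ 1 / 10) {A B : ℂ} (hA : ‖A‖ = 1) (hB : ‖B‖ = 1) :
    0 < meanCoeff ε A B := by
  have h1 := abs_le.1 hε
  have h2 : ‖A * conj B‖ = 1 := by rw [norm_mul, Complex.norm_conj, hA, hB, one_mul]
  have h3 := (abs_le.1 ((Complex.abs_re_le_norm (A * conj B)).trans h2.le)).1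
  have h4 : ‖(A * conj B) ^ 2‖ = 1 := by rw [norm_pow, h2, one_pow]
  have h5 := (abs_le.1 ((Complex.abs_re_le_norm ((A * conj B) ^ 2)).trans h4.le)).1
  have h6 : ε ^ 2 ≤ 1 / 100 := by nlinarith
  have h7 : ε ^ 4 ≤ 1 / 100 := by nlinarith [sq_nonneg ε]
  unfold meanCoeff
  nlinarith [mul_nonneg (sq_nonneg ε) (by linarith : 0 ≤ 1 + (A * conj B).re),
    mul_nonneg (by positivity : 0 ≤ ε ^ 4) (by linarith : 0 ≤ 1 + ((A * conj B) ^ 2).re)]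

theorem IsFluxWeight.fluxMean_pos {q ε : ℝ} {w : ℝ → ℝ} (hw : IsFluxWeight q w) (hq0 : 0 ≤ q)
    (hq : q < 2) (ω : ℝ) (hw0 : ∀ s ∈ Ioo (0 : ℝ) 1, 0 < w s) (hε : |ε| ≤ 1 / 10) :
    0 < fluxMean ε ω w := by
  rw [fluxMean, ← integral_Ioc_eq_integral_Ioo, ← intervalIntegral.integral_of_le zero_le_one]
  refine intervalIntegral.intervalIntegral_pos_of_pos_on ?_ (fun s hs => ?_) zero_lt_one
  · rw [intervalIntegrable_iff_integrableOn_Ioo_of_le zero_le_one]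
    exact hw.integrableOn_mean hq0 hq ε ω
  · exact mul_pos (mul_pos (hw0 s hs) hs.1) (mul_pos
      (meanCoeff_pos hε (norm_phase _ _) (norm_phase _ _)) (neg_pos.2 (Real.log_neg hs.1 hs.2)))

/-- The modulated power law carrying the flux `J₀`. -/
noncomputable def modulatedPowerLaw (γ J₀ ε ω : ℝ) (w : ℝ → ℝ) (x : ℝ) : ℝ :=
  √(J₀ / fluxMean ε ω w) * x ^ (-((γ + 3) / 2)) * profile ε ω (Real.log x)

theorem isConstantFluxSolution_modulatedPowerLaw {γ q ε ω J₀ : ℝ} {w : ℝ → ℝ} (hJ : 0 < J₀)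
    (hw : IsFluxWeight q w) (hq0 : 0 ≤ q) (hq : q < 2) (hω : 0 < ω)
    (hw0 : ∀ s ∈ Ioo (0 : ℝ) 1, 0 < w s) (hε : |ε| ≤ 1 / 10)
    (hmom : ∀ m : Fin 4, (ε : ℂ) ^ (m.1 + 1) *
      ∫ s in Ioo (0 : ℝ) 1, (w s : ℂ) * modalCurve ε ω s m = 0) :
    IsConstantFluxSolution (weightKernel γ w) J₀ (modulatedPowerLaw γ J₀ ε ω w) := by
  have hΛ := hw.fluxMean_pos hq0 hq ω hw0 hε
  refine ⟨?_, fun x hx => ?_, fun x hx => ?_⟩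
  · have hlog : ContinuousOn Real.log (Ioi 0) :=
      Real.continuousOn_log.mono fun s hs => ne_of_gt hs
    refine ContinuousOn.mul (continuousOn_const.mul ?_)
      ((continuous_profile ε ω).comp_continuousOn hlog)
    exact ContinuousOn.rpow_const continuousOn_id fun x hx => Or.inl (ne_of_gt hx)
  · exact mul_nonneg (mul_nonneg (Real.sqrt_nonneg _) (Real.rpow_nonneg (le_of_lt hx) _))
      (profile_pos hε _ _).le
  · refine (flux_modulated_eq hw hq0 hq hω (fun s hs => (hw0 s hs).le)
      (fun t => (profile_pos hε ω t).le) hmom hx).trans ?_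
    rw [Real.sq_sqrt (div_pos hJ hΛ).le, div_mul_cancel₀ _ hΛ.ne']

theorem profile_zero (ω t : ℝ) : profile 0 ω t = 1 := by simp [profile]

/-- The integral defining `bConst` is the flux at x = 1 of the power law with C = 1, i.e. the case ε
= 0 of the modulated solution. -/
theorem bConst_weightKernel {γ q ω : ℝ} {w : ℝ → ℝ} (hw : IsFluxWeight q w) (hq0 : 0 ≤ q)
    (hq : q < 2) (hω : 0 < ω) (hw0 : ∀ s ∈ Ioo (0 : ℝ) 1, 0 < w s) :
    bConst γ (angularPart (weightKernel γ w)) = fluxMean 0 ω w ^ (-(1 / 2) : ℝ) := by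
  have hflux := flux_modulated_eq (γ := γ) (C := 1) (ε := 0) hw hq0 hq hω
    (fun s hs => (hw0 s hs).le) (fun t => by rw [profile_zero]; exact zero_le_one)
    (fun m => by simp) one_pos
  have h0 := hw.fluxMean_pos (ε := 0) hq0 hq ω hw0 (by norm_num)
  rw [bConst]
  congr 1
  rw [one_pow, one_mul] at hflux
  rw [← ENNReal.toReal_ofReal h0.le, ← hflux, flux]
  congr 1
  refine setLIntegral_congr_fun measurableSet_Ioo fun y hy => ?_
  refine setLIntegral_congr_fun measurableSet_Ioi fun z hz => ?_
  have hy0 : 0 < y := hy.1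
  have hz0 : 0 < z := (sub_pos.2 hy.2).trans hz
  congr 1
  rw [angularPart_weightKernel, weightKernel, profile_zero, profile_zero,
    Real.rpow_neg hy0.le, Real.rpow_neg hz0.le]
  have h1 : y ^ ((γ + 3) / 2) = y ^ ((γ + 1) / 2) * y := by
    rw [← Real.rpow_add_one hy0.ne']; congr 1; ring
  rw [h1]
  have a1 := (Real.rpow_pos_of_pos hy0 ((γ + 1) / 2)).ne'
  have a2 := (Real.rpow_pos_of_pos hz0 ((γ + 3) / 2)).ne'
  have a3 := hy0.ne'
  generalize (y / (y + z) * (1 - y / (y + z))) ^ ((γ + 3) / 2) = T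
  generalize (y + z) ^ γ = S
  generalize w (y / (y + z)) = W
  field_simp

theorem powerLaw_isConstantFluxSolution {γ q ω J₀ : ℝ} {w : ℝ → ℝ} (hJ : 0 < J₀)
    (hw : IsFluxWeight q w) (hq0 : 0 ≤ q) (hq : q < 2) (hω : 0 < ω)
    (hw0 : ∀ s ∈ Ioo (0 : ℝ) 1, 0 < w s) :
    0 < bConst γ (angularPart (weightKernel γ w)) ∧
      IsConstantFluxSolution (weightKernel γ w) J₀
        (powerLawSolution γ (weightKernel γ w) J₀) := by
  have h0 := hw.fluxMean_pos (ε := 0) hq0 hq ω hw0 (by norm_num)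
  have hb := bConst_weightKernel (γ := γ) hw hq0 hq hω hw0
  refine ⟨hb ▸ Real.rpow_pos_of_pos h0 _, ?_⟩
  have h1 := isConstantFluxSolution_modulatedPowerLaw (γ := γ) (ε := 0) hJ hw hq0 hq hω hw0
    (by norm_num) (fun m => by simp)
  have he : powerLawSolution γ (weightKernel γ w) J₀ = modulatedPowerLaw γ J₀ 0 ω w := by
    funext x
    rw [powerLawSolution, modulatedPowerLaw, profile_zero, mul_one, hb, Real.rpow_neg h0.le,
      ← Real.sqrt_eq_rpow, Real.sqrt_div hJ.le, inv_mul_eq_div]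
  rwa [he]

theorem modulatedPowerLaw_scaling {ω : ℝ} (hω : 0 < ω) (γ J₀ ε : ℝ) (w : ℝ → ℝ) {x : ℝ}
    (hx : 0 < x) :
    modulatedPowerLaw γ J₀ ε ω w (Real.exp (2 * Real.pi / ω) * x) =
      Real.exp (2 * Real.pi / ω) ^ (-((γ + 3) / 2)) * modulatedPowerLaw γ J₀ ε ω w x := by
  have hQ := Real.exp_pos (2 * Real.pi / ω)
  have hp : profile ε ω (Real.log (Real.exp (2 * Real.pi / ω) * x))
      = profile ε ω (Real.log x) := by
    rw [Real.log_mul hQ.ne' hx.ne', Real.log_exp]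
    have h1 : ω * (2 * Real.pi / ω + Real.log x) = ω * Real.log x + 2 * Real.pi := by
      field_simp; ring
    have h2 : 2 * (ω * Real.log x + 2 * Real.pi)
        = 2 * (ω * Real.log x) + 2 * Real.pi + 2 * Real.pi := by ring
    rw [profile, profile, h1, h2, Real.cos_add_two_pi, Real.cos_add_two_pi, Real.cos_add_two_pi]
  rw [modulatedPowerLaw, modulatedPowerLaw, hp, Real.mul_rpow hQ.le hx.le]
  ring

/-- A power law satisfies f(r) f(r³) = f(r²)². With r a quarter period, r⁴ = Q, the three profile
values are 1 - (3/5)ε², 1 - 2ε + (3/5)ε² and 1 - (3/5)ε², and the identity would give ε(2 -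
(6/5)ε)(2 - 2ε) = 0. -/
theorem modulatedPowerLaw_ne_powerLaw {ω ε : ℝ} (hω : 0 < ω) (hε : |ε| ≤ 1 / 10) (hε0 : ε ≠ 0)
    (γ J₀ : ℝ) (w : ℝ → ℝ) (hc : 0 < J₀ / fluxMean ε ω w) :
    ¬ ∃ C a : ℝ, ∀ x ∈ Ioo 1 (Real.exp (2 * Real.pi / ω)),
      modulatedPowerLaw γ J₀ ε ω w x = C * x ^ a := by
  rintro ⟨C, a, h⟩
  have pi := Real.pi_pos
  obtain ⟨r, hr⟩ : ∃ r, r = Real.exp (Real.pi / 2 / ω) := ⟨_, rfl⟩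
  have hr0 : 0 < r := hr ▸ Real.exp_pos _
  have hpow : ∀ k : ℕ, r ^ k = Real.exp (k * (Real.pi / 2 / ω)) := by
    intro k; rw [hr, Real.exp_nat_mul]
  have hmem : ∀ k : ℕ, 0 < k → k < 4 → r ^ k ∈ Ioo 1 (Real.exp (2 * Real.pi / ω)) := by
    intro k h1 h2
    have h1' : (0 : ℝ) < k := by exact_mod_cast h1
    have h2' : (k : ℝ) < 4 := by exact_mod_cast h2
    rw [hpow]
    constructor
    · exact Real.one_lt_exp_iff.2 (by positivity)
    · refine Real.exp_lt_exp.2 ?_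
      rw [show 2 * Real.pi / ω = 4 * (Real.pi / 2 / ω) by ring]
      exact mul_lt_mul_of_pos_right h2' (by positivity)
  have hval : ∀ k : ℕ, modulatedPowerLaw γ J₀ ε ω w (r ^ k) =
      √(J₀ / fluxMean ε ω w) * (r ^ (-((γ + 3) / 2))) ^ k *
        (1 + 2 * ε * Real.cos (k * (Real.pi / 2)) + 3 / 5 * ε ^ 2 * Real.cos (k * Real.pi)) := by
    intro k
    rw [modulatedPowerLaw, profile]
    have e1 : ω * Real.log (r ^ k) = k * (Real.pi / 2) := by
      rw [hpow, Real.log_exp]; field_simp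
    rw [e1, show 2 * ((k : ℝ) * (Real.pi / 2)) = k * Real.pi by ring]
    congr 2
    rw [← Real.rpow_natCast, ← Real.rpow_natCast, ← Real.rpow_mul hr0.le, ← Real.rpow_mul hr0.le,
      mul_comm]
  have hrhs : ∀ k : ℕ, (r ^ k) ^ a = (r ^ a) ^ k := by
    intro k
    rw [← Real.rpow_natCast, ← Real.rpow_natCast, ← Real.rpow_mul hr0.le, ← Real.rpow_mul hr0.le,
      mul_comm]
  have h1 := h _ (hmem 1 (by norm_num) (by norm_num))
  have h2 := h _ (hmem 2 (by norm_num) (by norm_num))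
  have h3 := h _ (hmem 3 (by norm_num) (by norm_num))
  rw [hval, hrhs] at h1 h2 h3
  have c1 : Real.cos ((1 : ℕ) * (Real.pi / 2)) = 0 := by simp
  have c2 : Real.cos ((2 : ℕ) * (Real.pi / 2)) = -1 := by
    rw [show ((2 : ℕ) : ℝ) * (Real.pi / 2) = Real.pi by push_cast; ring, Real.cos_pi]
  have c3 : Real.cos ((3 : ℕ) * (Real.pi / 2)) = 0 := by
    rw [show ((3 : ℕ) : ℝ) * (Real.pi / 2) = Real.pi / 2 + Real.pi by push_cast; ring,
      Real.cos_add_pi, Real.cos_pi_div_two, neg_zero]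
  have d1 : Real.cos ((1 : ℕ) * Real.pi) = -1 := by simp
  have d2 : Real.cos ((2 : ℕ) * Real.pi) = 1 := by simp
  have d3 : Real.cos ((3 : ℕ) * Real.pi) = -1 := by
    rw [show ((3 : ℕ) : ℝ) * Real.pi = Real.pi + 2 * Real.pi by push_cast; ring,
      Real.cos_add_two_pi, Real.cos_pi]
  rw [c1, d1] at h1
  rw [c2, d2] at h2
  rw [c3, d3] at h3
  obtain ⟨κ, hκ⟩ : ∃ κ, κ = √(J₀ / fluxMean ε ω w) := ⟨_, rfl⟩
  obtain ⟨ρ, hρ⟩ : ∃ ρ, ρ = r ^ (-((γ + 3) / 2)) := ⟨_, rfl⟩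
  have hκ0 : κ ≠ 0 := hκ ▸ (Real.sqrt_pos.2 hc).ne'
  have hρ0 : ρ ≠ 0 := hρ ▸ (Real.rpow_pos_of_pos hr0 _).ne'
  rw [← hκ, ← hρ] at h1 h2 h3
  have key : (κ ^ 2 * ρ ^ 4) * ((1 - 3 / 5 * ε ^ 2) ^ 2 - (1 - 2 * ε + 3 / 5 * ε ^ 2) ^ 2) = 0 := by
    linear_combination (κ * ρ ^ 3 * (1 - 3 / 5 * ε ^ 2)) * h1 + (C * (r ^ a)) * h3
      - (κ * ρ ^ 2 * (1 - 2 * ε + 3 / 5 * ε ^ 2)) * h2 - C * (r ^ a) ^ 2 * h2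
  have hne : κ ^ 2 * ρ ^ 4 ≠ 0 := mul_ne_zero (pow_ne_zero _ hκ0) (pow_ne_zero _ hρ0)
  have key2 : ε * ((2 - 6 / 5 * ε) * (2 - 2 * ε)) = 0 := by
    linear_combination (mul_eq_zero.1 key).resolve_left hne
  have hb := abs_le.1 hε
  refine (mul_pos (by linarith : 0 < 2 - 6 / 5 * ε) (by linarith : 0 < 2 - 2 * ε)).ne'
    ((mul_eq_zero.1 key2).resolve_left hε0)

/-! ### The family of kernels and its continuity -/

/-- The kernels differ only in the coefficients of two fixed bumps, so the singular part cancels and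
the distance is finite and controlled by those coefficients. -/
theorem edist_weightKernel_le {γ p M₁ M₂ x x' y y' : ℝ} {v h k : ℝ → ℝ}
    (hM₁ : ∀ s ∈ Ioo (0 : ℝ) 1, s ^ p * (s * (1 - s)) ^ ((γ + 3) / 2) * |h s| ≤ M₁)
    (hM₂ : ∀ s ∈ Ioo (0 : ℝ) 1, s ^ p * (s * (1 - s)) ^ ((γ + 3) / 2) * |k s| ≤ M₂) :
    angularDist p (angularPart (weightKernel γ fun s => v s + (x * h s + y * k s)))
      (angularPart (weightKernel γ fun s => v s + (x' * h s + y' * k s))) ≤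
      ENNReal.ofReal (|x - x'| * M₁ + |y - y'| * M₂) := by
  refine iSup₂_le fun s hs => ENNReal.ofReal_le_ofReal ?_
  have hp : 0 ≤ s ^ p := Real.rpow_nonneg hs.1.le p
  have ha : 0 ≤ (s * (1 - s)) ^ ((γ + 3) / 2) :=
    Real.rpow_nonneg (mul_pos hs.1 (sub_pos.2 hs.2)).le _
  rw [angularPart_weightKernel, angularPart_weightKernel]
  have e : (v s + (x * h s + y * k s)) * (s * (1 - s)) ^ ((γ + 3) / 2) -
      (v s + (x' * h s + y' * k s)) * (s * (1 - s)) ^ ((γ + 3) / 2) =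
      ((x - x') * h s + (y - y') * k s) * (s * (1 - s)) ^ ((γ + 3) / 2) := by ring
  rw [e, abs_mul, abs_of_nonneg ha]
  have h1 : |(x - x') * h s + (y - y') * k s| ≤ |x - x'| * |h s| + |y - y'| * |k s| := by
    rw [← abs_mul, ← abs_mul]; exact abs_add_le _ _
  have h2 := mul_le_mul_of_nonneg_left (hM₁ s hs) (abs_nonneg (x - x'))
  have h3 := mul_le_mul_of_nonneg_left (hM₂ s hs) (abs_nonneg (y - y'))
  have h4 := mul_le_mul_of_nonneg_left h1 (mul_nonneg hp ha)
  linarith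

theorem IsSymmBump.exists_weighted_bound {h : ℝ → ℝ} (hh : IsSymmBump h) (γ p : ℝ) :
    ∃ M : ℝ, ∀ s ∈ Ioo (0 : ℝ) 1, s ^ p * (s * (1 - s)) ^ ((γ + 3) / 2) * |h s| ≤ M := by
  have hg : ContinuousOn (fun s : ℝ => s ^ p * (s * (1 - s)) ^ ((γ + 3) / 2)) (Ioo 0 1) := by
    refine (ContinuousOn.rpow_const continuousOn_id fun s hs => Or.inl hs.1.ne').mul
      (ContinuousOn.rpow_const (by fun_prop) fun s hs => Or.inl ?_)
    exact (mul_pos hs.1 (sub_pos.2 hs.2)).ne'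
  obtain ⟨M, -, hM⟩ := hh.exists_bound_mul hg
  refine ⟨M, fun s hs => ?_⟩
  have h1 := hM s
  rwa [abs_mul, abs_of_nonneg] at h1
  exact mul_nonneg (Real.rpow_nonneg hs.1.le p)
    (Real.rpow_nonneg (mul_pos hs.1 (sub_pos.2 hs.2)).le _)

/-- A continuous family of weights, bounded below, for which all relevant modes of the flux of
the modulated power law vanish. -/
theorem exists_weight_family {q : ℝ} (hq0 : 0 ≤ q) (hq : q < 2) :
    ∃ ω : ℝ, 0 < ω ∧ ∃ h₀ h₁ h₂ : ℝ → ℝ, IsSymmBump h₀ ∧ IsSymmBump h₁ ∧ IsSymmBump h₂ ∧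
      ∃ δ : ℝ, 0 < δ ∧ ∃ X Y : ℝ → ℝ, ContinuousOn X (Ioo (-δ) δ) ∧ ContinuousOn Y (Ioo (-δ) δ) ∧
      ∀ ε ∈ Ioo (-δ) δ,
        (∀ s ∈ Ioo (0 : ℝ) 1,
          0 < (s * (1 - s)) ^ (-q) + (h₀ s + (X ε * h₁ s + Y ε * h₂ s))) ∧
        ∀ m : Fin 4, ∫ s in Ioo (0 : ℝ) 1,
          (((s * (1 - s)) ^ (-q) + (h₀ s + (X ε * h₁ s + Y ε * h₂ s)) : ℝ) : ℂ)
            * modalCurve ε ω s m = 0 := by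
  obtain ⟨ω, hω, hsurj⟩ := exists_frequency_forall_bump
  have hzero : IsSymmBump fun _ => 0 :=
    ⟨continuous_const, fun _ => rfl, 1, one_pos, fun _ _ => rfl⟩
  have hwb := isFluxWeight_base_add hq0 hzero
  simp only [add_zero] at hwb
  let v : ℝ → ℝ := fun s => (s * (1 - s)) ^ (-q)
  -- The bump h₀ may be large, so its sign is needed for positivity of the weight. The next two
  -- enter with small coefficients of either sign, and only their moments matter.
  obtain ⟨h₀, hb₀, hpos₀, hm₀⟩ := hsurj (-modeIntegral ω v)
  obtain ⟨h₁, hb₁, -, hm₁⟩ := hsurj (Pi.single 0 1)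
  obtain ⟨h₂, hb₂, -, hm₂⟩ := hsurj (Pi.single 0 Complex.I)
  obtain ⟨M₁, hM₁0, hM₁⟩ := hb₁.exists_bound
  obtain ⟨M₂, hM₂0, hM₂⟩ := hb₂.exists_bound
  -- This bound on X and Y keeps |X h₁ + Y h₂| below 1, the lower bound of the base weight.
  have hη : 0 < 1 / (2 * (M₁ + M₂ + 1)) := by positivity
  obtain ⟨δ, hδ, X, Y, hX, hY, hXY⟩ := exists_continuous_solution
    (corrIntegral ω v + corrIntegral ω h₀) (corrIntegral ω h₁) (corrIntegral ω h₂) hη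
  refine ⟨ω, hω, h₀, h₁, h₂, hb₀, hb₁, hb₂, δ, hδ, X, Y, hX, hY, fun ε hε => ?_⟩
  obtain ⟨hX1, hY1, heq⟩ := hXY ε hε
  have hbXY : IsSymmBump fun s => X ε * h₁ s + Y ε * h₂ s :=
    (hb₁.const_mul _).add (hb₂.const_mul _)
  have hball := hb₀.add hbXY
  refine ⟨fun s hs => ?_, fun m => ?_⟩
  · have h1 := one_le_base_weight hq0 hs
    have h2 : |X ε * h₁ s + Y ε * h₂ s| ≤ 1 / (2 * (M₁ + M₂ + 1)) * (M₁ + M₂) := by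
      refine (abs_add_le _ _).trans ?_
      rw [abs_mul, abs_mul, mul_add]
      exact add_le_add (mul_le_mul hX1 (hM₁ s) (abs_nonneg _) hη.le)
        (mul_le_mul hY1 (hM₂ s) (abs_nonneg _) hη.le)
    have h3 : 1 / (2 * (M₁ + M₂ + 1)) * (M₁ + M₂) < 1 := by
      rw [one_div_mul_eq_div, div_lt_one (by positivity)]
      linarith
    have h4 := (abs_le.1 h2).1
    have h5 := hpos₀ s
    linarith
  · have hw := isFluxWeight_base_add hq0 hball
    rw [integral_modalCurve (w := fun s => (s * (1 - s)) ^ (-q)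
        + (h₀ s + (X ε * h₁ s + Y ε * h₂ s)))
      (hw.integrableOn_modeCurve hq0 hq hω) (hw.integrableOn_corrCurve hq0 hq hω)]
    have iv := hwb.integrableOn_modeCurve hq0 hq hω
    have cv := hwb.integrableOn_corrCurve hq0 hq hω
    have im : ∀ h, IsSymmBump h → ∀ m,
        IntegrableOn (fun s => (h s : ℂ) * modeCurve ω s m) (Ioo 0 1) :=
      fun h hh m => hh.integrableOn_mul (continuousOn_modeCurve ω m)
    have ic : ∀ h, IsSymmBump h →
        IntegrableOn (fun s => (h s : ℂ) * corrCurve ω s) (Ioo 0 1) :=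
      fun h hh => hh.integrableOn_mul (continuousOn_corrCurve ω)
    have e1 := modeIntegral_linear ω iv (im _ hball) 1 1
    have e2 := modeIntegral_linear ω (im _ hb₀) (im _ hbXY) 1 1
    have e3 := modeIntegral_linear ω (im _ hb₁) (im _ hb₂) (X ε) (Y ε)
    have f1 := corrIntegral_add_mul cv (ic _ hball) 1 1
    have f2 := corrIntegral_add_mul (ic _ hb₀) (ic _ hbXY) 1 1
    have f3 := corrIntegral_add_mul (ic _ hb₁) (ic _ hb₂) (X ε) (Y ε)
    simp only [one_mul, one_smul, Complex.ofReal_one] at e1 e2 f1 f2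
    rw [e1, e2, e3, f1, f2, f3, hm₀, hm₁, hm₂]
    by_cases h0 : m = 0
    · subst h0
      simp only [Pi.add_apply, Pi.neg_apply, Pi.smul_apply, Pi.single_eq_same,
        Complex.real_smul, mul_one]
      linear_combination heq
    · simp [Pi.single_eq_of_ne h0, v]

end Coagulation

/-- Bifurcation of log-periodic constant flux solutions from the power law. -/
theorem theorem1p1 (J₀ : ℝ) (hJ₀ : 0 < J₀) (γ p : ℝ) (h0 : 0 ≤ γ + 2 * p)
    (h1 : γ + 2 * p < 1) :
    ∃ δ : ℝ, 0 < δ ∧ ∃ K : Set.Ioo (-δ) δ → Coagulation.KernelClass γ p,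
      Continuous K ∧
      ∃ Q : ℝ, 1 < Q ∧
        ∀ d : Set.Ioo (-δ) δ, (d : ℝ) ≠ 0 →
          (0 < Coagulation.bConst γ (Coagulation.angularPart (K d).1) ∧
            Coagulation.IsConstantFluxSolution (K d).1 J₀
              (Coagulation.powerLawSolution γ (K d).1 J₀)) ∧
          ∃ f : ℝ → ℝ,
            Coagulation.IsConstantFluxSolution (K d).1 J₀ f ∧
            (∀ x > 0, f (Q * x) = Q ^ (-((γ + 3) / 2)) * f x) ∧
            ¬ ∃ C a : ℝ, ∀ x ∈ Set.Ioo 1 Q, f x = C * x ^ a := by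
  open Coagulation in
  -- The exponent q = p + (γ+3)/2 = (γ + 2p + 3)/2 lies in [3/2, 2).
  have hq0 : 0 ≤ p + (γ + 3) / 2 := by linarith
  have hq : p + (γ + 3) / 2 < 2 := by linarith
  obtain ⟨ω, hω, h₀, h₁, h₂, hb₀, hb₁, hb₂, δ', hδ', X, Y, hX, hY, hfam⟩ :=
    exists_weight_family hq0 hq
  obtain ⟨M₁, hM₁⟩ := hb₁.exists_weighted_bound γ p
  obtain ⟨M₂, hM₂⟩ := hb₂.exists_weighted_bound γ p
  let v : ℝ → ℝ := fun s => (s * (1 - s)) ^ (-(p + (γ + 3) / 2)) + h₀ s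
  let w : ℝ → ℝ → ℝ := fun ε s => v s + (X ε * h₁ s + Y ε * h₂ s)
  have hwe : ∀ ε, w ε = fun s => (s * (1 - s)) ^ (-(p + (γ + 3) / 2))
      + (h₀ s + (X ε * h₁ s + Y ε * h₂ s)) := fun ε => funext fun s => add_assoc _ _ _
  have hbump : ∀ ε, IsSymmBump fun s => h₀ s + (X ε * h₁ s + Y ε * h₂ s) := fun ε =>
    hb₀.add ((hb₁.const_mul _).add (hb₂.const_mul _))
  have hweight : ∀ ε, IsFluxWeight (p + (γ + 3) / 2) (w ε) := fun ε => by
    rw [hwe]; exact isFluxWeight_base_add hq0 (hbump ε)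
  -- The bound 1/10 keeps the profile and the mean flux positive.
  obtain ⟨δ, hδdef⟩ : ∃ δ, δ = min δ' (1 / 10) := ⟨_, rfl⟩
  have hδ : 0 < δ := hδdef ▸ lt_min hδ' (by norm_num)
  have hsub : Ioo (-δ) δ ⊆ Ioo (-δ') δ' := by
    have := hδdef ▸ min_le_left δ' (1 / 10)
    exact Ioo_subset_Ioo (by linarith) this
  have hsmall : ∀ d ∈ Ioo (-δ) δ, |d| ≤ 1 / 10 := fun d hd =>
    (abs_lt.2 hd).le.trans (hδdef ▸ min_le_right _ _)
  have hpos : ∀ d ∈ Ioo (-δ) δ, ∀ s ∈ Ioo (0 : ℝ) 1, 0 < w d s := by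
    intro d hd s hs
    rw [hwe]
    exact (hfam d (hsub hd)).1 s hs
  have hadm : ∀ d ∈ Ioo (-δ) δ, IsAdmissibleKernel γ p (weightKernel γ (w d)) := by
    intro d hd
    refine isAdmissibleKernel_weightKernel (hweight d).continuousOn (hweight d).symm (hpos d hd) ?_
    filter_upwards [(hbump d).eventually_eq_zero] with s hs
    rw [hwe]
    simp only [hs, add_zero]
  -- Q = e^(2π/ω) is one period of the profile in log x; ω was fixed before ε, so Q does not depend
  -- on the parameter.
  refine ⟨δ, hδ, fun d => ⟨weightKernel γ (w d), hadm d d.2⟩, ?_, Real.exp (2 * Real.pi / ω),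
    Real.one_lt_exp_iff.2 (by positivity), fun d hd => ⟨?_, ?_⟩⟩
  · refine continuous_iff_continuousAt.2 fun d => ?_
    refine tendsto_iff_edist_tendsto_0.2 ?_
    have hXc : Continuous fun e : Ioo (-δ) δ => X e := (hX.mono hsub).domRestrict
    have hYc : Continuous fun e : Ioo (-δ) δ => Y e := (hY.mono hsub).domRestrict
    have hc : Continuous fun e : Ioo (-δ) δ =>
        ENNReal.ofReal (|X e - X d| * M₁ + |Y e - Y d| * M₂) :=
      ENNReal.continuous_ofReal.comp
        (((hXc.sub continuous_const).abs.mul continuous_const).add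
          ((hYc.sub continuous_const).abs.mul continuous_const))
    have hlim := hc.tendsto d
    simp only [sub_self, abs_zero, zero_mul, add_zero, ENNReal.ofReal_zero] at hlim
    exact tendsto_of_tendsto_of_tendsto_of_le_of_le tendsto_const_nhds hlim
      (fun _ => zero_le) fun e => edist_weightKernel_le hM₁ hM₂
  · exact powerLaw_isConstantFluxSolution hJ₀ (hweight d) hq0 hq hω (hpos d d.2)
  · have hmom : ∀ m : Fin 4, ((d : ℝ) : ℂ) ^ (m.1 + 1) *
        ∫ s in Ioo (0 : ℝ) 1, (w d s : ℂ) * modalCurve d ω s m = 0 := by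
      intro m
      rw [hwe, (hfam d (hsub d.2)).2 m, mul_zero]
    refine ⟨modulatedPowerLaw γ J₀ d ω (w d), isConstantFluxSolution_modulatedPowerLaw hJ₀
      (hweight d) hq0 hq hω (hpos d d.2) (hsmall d d.2) hmom,
      fun x hx => modulatedPowerLaw_scaling hω γ J₀ d (w d) hx, ?_⟩
    exact modulatedPowerLaw_ne_powerLaw hω (hsmall d d.2) hd γ J₀ (w d)
      (div_pos hJ₀ ((hweight d).fluxMean_pos hq0 hq ω (hpos d d.2) (hsmall d d.2)))
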